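/- Let $B_n$ denote the Bernoulli polynomials, $\sum_{n\ge 0}B_n(x)\frac{z^n}{n!}=\frac{e^{xz}}{g(z)}$, where $g$ is the entire function $g(z)=\frac{e^z-1}{z}$, $g(0)=1$, and let $\beta_n(x)=B_n(nx)$. Let $\Theta(t)=1$ for $t>0$, $\Theta(0)=\tfrac12$, $\Theta(t)=0$ for $t<0$; let $\mathrm{Arg}$ take values in $(-\pi,\pi]$; and let $\mathrm{Li}_n(z)=\sum_{k\ge1}z^k/k^n$ for $|z|<1$. For $\tau>0$ let $\theta_+(\tau)$ be the unique $\theta\in\mathbb{C}$ with $0<\mathrm{Re}\,\theta<\pi$, $\mathrm{Im}\,\theta<0$ and $e^{i\theta}-i\theta=1-\tau^2$, and define $\theta:\mathbb{R}\to\mathbb{C}$ by $\theta(\tau)=\theta_+(\tau)$ for $\tau>0$, $\theta(0)=0$, and $\theta(\tau)=-\overline{\theta_+(-\tau)}$ for $\tau<0$. Let $n\ge 1$ be an integer and $x\in\mathbb{C}\setminus\{0\}$. Then the principal value integral $$J_n(x)=\mathrm{PV}\!\int_{-\infty}^{+\infty}\frac{e^{-n\tau^2}\,\theta'(\tau)}{g\big(e^{i\theta(\tau)}/x\big)}\,d\tau$$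 exists, where the principal value is taken symmetrically in $\tau$ at the real zeros (if any) of $\tau\mapsto g(e^{i\theta(\tau)}/x)$, the integrand being absolutely integrable away from them, and the following hold. (1) If $\mathrm{Re}(x)\ne0$, then $$\frac{\beta_n(x)}{n!}=\frac{(ex)^n}{2\pi}J_n(x)-\frac{1}{(2\pi)^n}\sum_{k\ge1}\Theta\Big(\frac{\mathrm{Arg}(ix)}{2\pi\,\mathrm{Im}(ix)}-k\Big)\frac{e^{2k\pi i n x}}{(ik)^n}-\frac{1}{(2\pi)^n}\sum_{k\ge1}\Theta\Big(\frac{\mathrm{Arg}(-ix)}{2\pi\,\mathrm{Im}(-ix)}-k\Big)\frac{e^{-2k\pi i n x}}{(-ik)^n},$$ where both sums are finite. (2) If $x=iq$ with $q>0$, then $$\frac{\beta_n(x)}{n!}=\frac{(ex)^n}{2\pi}J_n(x)-\frac{1}{(2\pi i)^n}\mathrm{Li}_n\big(e^{2\pi i n x}\big)-\frac{1}{(2\pi)^n}\sum_{k\ge1}\Theta\Big(\frac{1}{2\pi\,\mathrm{Im}(x)}-k\Big)\frac{e^{-2\pi i k n x}}{(-ik)^n}.$$ (3) If $x=iq$ with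 $q<0$, then the complex conjugate formula holds: $$\frac{\beta_n(x)}{n!}=\frac{(ex)^n}{2\pi}J_n(x)-\frac{1}{(-2\pi i)^n}\mathrm{Li}_n\big(e^{-2\pi i n x}\big)-\frac{1}{(2\pi)^n}\sum_{k\ge1}\Theta\Big(\frac{1}{2\pi\,\mathrm{Im}(-x)}-k\Big)\frac{e^{2\pi i k n x}}{(ik)^n}.$$ -/

import Mathlib

open MeasureTheory Filter Topology

namespace RescaledBernoulli

/-- The entire function `g(z) = (e^z - 1) / z`, with `g(0) = 1`. -/
noncomputable def g (z : ℂ) : ℂ :=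
  if z = 0 then 1 else (Complex.exp z - 1) / z

/-- The rescaled Bernoulli polynomial `β_n(x) = B_n(n x)`. -/
noncomputable def beta (n : ℕ) (x : ℂ) : ℂ :=
  Polynomial.aeval ((n : ℂ) * x) (Polynomial.bernoulli n)

/-- The step function with value `1/2` at the origin. -/
noncomputable def step (t : ℝ) : ℝ :=
  if 0 < t then 1 else if t = 0 then 1 / 2 else 0

/-- The half-strip `0 < Re θ < π`, `Im θ < 0`. -/
def Omega : Set ℂ := {θ | 0 < θ.re ∧ θ.re < Real.pi ∧ θ.im < 0}

/-- The function `X ↦ X cot X + log (sin X / X)`: the value of `e^{iθ} - iθ` at the point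
`θ = X + i log (sin X / X)` of the steepest descent curve. -/
noncomputable def height (X : ℝ) : ℝ :=
  X * (Real.cos X / Real.sin X) + (Real.log (Real.sin X) - Real.log X)

theorem hasDerivAt_height {X : ℝ} (h0 : 0 < X) (hpi : X < Real.pi) :
    HasDerivAt height
      (-(((X - Real.sin X * Real.cos X) ^ 2 + Real.sin X ^ 4) / (X * Real.sin X ^ 2))) X := by
  have hs : 0 < Real.sin X := Real.sin_pos_of_pos_of_lt_pi h0 hpi
  have h := ((hasDerivAt_id X).mul
    ((Real.hasDerivAt_cos X).div (Real.hasDerivAt_sin X) hs.ne')).add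
    (((Real.hasDerivAt_sin X).log hs.ne').sub ((hasDerivAt_id X).log h0.ne'))
  refine h.congr_deriv ?_
  have hc : Real.cos X ^ 2 = 1 - Real.sin X ^ 2 := by
    have := Real.sin_sq_add_cos_sq X; linarith
  simp only [id, Pi.div_apply]
  field_simp
  ring_nf
  simp only [hc]
  ring

theorem height_strictAntiOn : StrictAntiOn height (Set.Ioo 0 Real.pi) := by
  refine strictAntiOn_of_deriv_neg (convex_Ioo _ _)
    (fun X hX => (hasDerivAt_height hX.1 hX.2).continuousAt.continuousWithinAt) ?_
  intro X hX
  rw [interior_Ioo] at hX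
  rw [(hasDerivAt_height hX.1 hX.2).deriv]
  have hs : 0 < Real.sin X := Real.sin_pos_of_pos_of_lt_pi hX.1 hX.2
  have h0 := hX.1
  have : 0 < ((X - Real.sin X * Real.cos X) ^ 2 + Real.sin X ^ 4) / (X * Real.sin X ^ 2) := by
    positivity
  linarith

theorem mem_Omega_and_eq_iff (τ : ℝ) (θ : ℂ) :
    (θ ∈ Omega ∧ Complex.exp (Complex.I * θ) - Complex.I * θ = 1 - (τ : ℂ) ^ 2) ↔
      (0 < θ.re ∧ θ.re < Real.pi ∧ θ.im = Real.log (Real.sin θ.re) - Real.log θ.re ∧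
        height θ.re = 1 - τ ^ 2) := by
  have hre : (Complex.exp (Complex.I * θ) - Complex.I * θ).re
      = Real.exp (-θ.im) * Real.cos θ.re + θ.im := by
    simp [Complex.exp_re]
  have him : (Complex.exp (Complex.I * θ) - Complex.I * θ).im
      = Real.exp (-θ.im) * Real.sin θ.re - θ.re := by
    simp [Complex.exp_im]
  have hr : ((1 : ℂ) - (τ : ℂ) ^ 2) = ((1 - τ ^ 2 : ℝ) : ℂ) := by push_cast; ring
  rw [hr, Complex.ext_iff, hre, him, Complex.ofReal_re, Complex.ofReal_im]
  have key : ∀ X Y : ℝ, 0 < X → X < Real.pi → Y = Real.log (Real.sin X) - Real.log X →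
      Real.exp (-Y) = X / Real.sin X := by
    intro X Y h0 hpi hY
    have hs : 0 < Real.sin X := Real.sin_pos_of_pos_of_lt_pi h0 hpi
    rw [hY, neg_sub, Real.exp_sub, Real.exp_log h0, Real.exp_log hs]
  constructor
  · rintro ⟨⟨h0, hpi, -⟩, h1, h2⟩
    have hs : 0 < Real.sin θ.re := Real.sin_pos_of_pos_of_lt_pi h0 hpi
    have hY : θ.im = Real.log (Real.sin θ.re) - Real.log θ.re := by
      have h3 : Real.exp (-θ.im) * Real.sin θ.re = θ.re := by linarith
      have h4 := congrArg Real.log h3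
      rw [Real.log_mul (Real.exp_pos _).ne' hs.ne', Real.log_exp] at h4
      linarith
    refine ⟨h0, hpi, hY, ?_⟩
    rw [key _ _ h0 hpi hY] at h1
    rw [← h1, height, ← hY]
    ring
  · rintro ⟨h0, hpi, hY, hh⟩
    have hs : 0 < Real.sin θ.re := Real.sin_pos_of_pos_of_lt_pi h0 hpi
    refine ⟨⟨h0, hpi, ?_⟩, ?_, ?_⟩
    · rw [hY]
      have := Real.log_lt_log hs (Real.sin_lt h0)
      linarith
    · rw [key _ _ h0 hpi hY, ← hh, height, ← hY]
      ring
    · rw [key _ _ h0 hpi hY]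
      field_simp
      ring

theorem tendsto_height_zero : Tendsto height (𝓝[>] 0) (𝓝 1) := by
  have hsinc : Tendsto (fun X : ℝ => Real.sinc X) (𝓝[>] 0) (𝓝 1) := by
    have := Real.continuous_sinc.tendsto 0
    rw [Real.sinc_zero] at this
    exact this.mono_left nhdsWithin_le_nhds
  have hcos : Tendsto Real.cos (𝓝[>] 0) (𝓝 1) := by
    have := Real.continuous_cos.tendsto 0
    rw [Real.cos_zero] at this
    exact this.mono_left nhdsWithin_le_nhds
  have h := (hcos.div hsinc one_ne_zero).add (hsinc.log one_ne_zero)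
  simp only [Real.log_one, div_one, add_zero] at h
  refine h.congr' ?_
  have hmem : Set.Ioo (0 : ℝ) Real.pi ∈ 𝓝[>] (0 : ℝ) := Ioo_mem_nhdsGT Real.pi_pos
  filter_upwards [hmem] with X hX
  have hs : 0 < Real.sin X := Real.sin_pos_of_pos_of_lt_pi hX.1 hX.2
  have hX0 : X ≠ 0 := hX.1.ne'
  simp only [Pi.div_apply, height, Real.sinc_of_ne_zero hX0]
  rw [Real.log_div hs.ne' hX0]
  field_simp

theorem exists_height_le (M : ℝ) : ∃ X ∈ Set.Ioo (0 : ℝ) Real.pi, height X ≤ M := by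
  have hs : Tendsto Real.sin (𝓝[<] Real.pi) (𝓝[>] 0) := by
    refine tendsto_nhdsWithin_iff.2 ⟨?_, ?_⟩
    · have := Real.continuous_sin.tendsto Real.pi
      rw [Real.sin_pi] at this
      exact this.mono_left nhdsWithin_le_nhds
    · have hmem : Set.Ioo (0 : ℝ) Real.pi ∈ 𝓝[<] Real.pi := Ioo_mem_nhdsLT Real.pi_pos
      filter_upwards [hmem] with X hX
      exact Real.sin_pos_of_pos_of_lt_pi hX.1 hX.2
  have hc : Tendsto (fun X : ℝ => X * Real.cos X) (𝓝[<] Real.pi) (𝓝 (-Real.pi)) := by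
    have h2 : Continuous (fun X : ℝ => X * Real.cos X) := by fun_prop
    exact (h2.tendsto' Real.pi (-Real.pi) (by simp)).mono_left nhdsWithin_le_nhds
  have h1 : Tendsto (fun X : ℝ => X * Real.cos X * (Real.sin X)⁻¹) (𝓝[<] Real.pi) atBot :=
    Tendsto.neg_mul_atTop (neg_neg_of_pos Real.pi_pos) hc (tendsto_inv_nhdsGT_zero.comp hs)
  have hmem : Set.Ioo (0 : ℝ) Real.pi ∈ 𝓝[<] Real.pi := Ioo_mem_nhdsLT Real.pi_pos
  obtain ⟨X, hXM, hX⟩ := ((h1.eventually_le_atBot M).and hmem).exists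
  refine ⟨X, hX, ?_⟩
  have hsX : 0 < Real.sin X := Real.sin_pos_of_pos_of_lt_pi hX.1 hX.2
  have hl := Real.log_lt_log hsX (Real.sin_lt hX.1)
  have : height X = X * Real.cos X * (Real.sin X)⁻¹
      + (Real.log (Real.sin X) - Real.log X) := by
    rw [height]; ring
  linarith

/-- For `τ > 0` the equation `e^{iθ} - iθ = 1 - τ²` has exactly one solution in `Omega`. -/
theorem existsUnique_thetaPlus {τ : ℝ} (hτ : 0 < τ) :
    ∃! θ : ℂ, θ ∈ Omega ∧
      Complex.exp (Complex.I * θ) - Complex.I * θ = 1 - (τ : ℂ) ^ 2 := by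
  have hlt : 1 - τ ^ 2 < 1 := by have : 0 < τ ^ 2 := by positivity
                                 linarith
  obtain ⟨b, hb, hbM⟩ := exists_height_le (1 - τ ^ 2)
  have hmem : Set.Ioo (0 : ℝ) Real.pi ∈ 𝓝[>] (0 : ℝ) := Ioo_mem_nhdsGT Real.pi_pos
  obtain ⟨a, haM, ha⟩ :=
    ((tendsto_height_zero.eventually (lt_mem_nhds hlt)).and hmem).exists
  have hcont : ContinuousOn height (Set.Ioo 0 Real.pi) := fun X hX =>
    (hasDerivAt_height hX.1 hX.2).continuousAt.continuousWithinAt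
  obtain ⟨X, hX, hXv⟩ := isPreconnected_Ioo.intermediate_value hb ha hcont ⟨hbM, haM.le⟩
  refine ⟨⟨X, Real.log (Real.sin X) - Real.log X⟩, ?_, ?_⟩
  · exact (mem_Omega_and_eq_iff τ _).2 ⟨hX.1, hX.2, rfl, hXv⟩
  · intro θ hθ
    obtain ⟨h0, hpi, hY, hh⟩ := (mem_Omega_and_eq_iff τ θ).1 hθ
    have hre : θ.re = X := height_strictAntiOn.injOn ⟨h0, hpi⟩ hX (hh.trans hXv.symm)
    apply Complex.ext
    · exact hre
    · simp only [hY, hre]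

/-- The solution `θ₊(τ)`, `τ > 0`, of `e^{iθ} - iθ = 1 - τ²` in `Omega`. -/
noncomputable def thetaPlus (τ : ℝ) (hτ : 0 < τ) : ℂ :=
  (existsUnique_thetaPlus hτ).choose

/-- The parametrization `θ : ℝ → ℂ` of the steepest descent curve through the saddle point `0`. -/
noncomputable def theta (τ : ℝ) : ℂ :=
  if h : 0 < τ then thetaPlus τ h
  else if h' : τ < 0 then -(starRingEnd ℂ) (thetaPlus (-τ) (neg_pos.2 h'))
  else 0

/-- The integrand `e^{-nτ²} θ'(τ) / g(e^{iθ(τ)} / x)`. -/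
noncomputable def integrand (n : ℕ) (x : ℂ) (τ : ℝ) : ℂ :=
  Complex.exp (-(n : ℂ) * (τ : ℂ) ^ 2) * deriv theta τ
    / g (Complex.exp (Complex.I * theta τ) / x)

/-- The points of the real line at which the integrand is singular. -/
def singularSet (x : ℂ) : Set ℝ :=
  {τ | g (Complex.exp (Complex.I * theta τ) / x) = 0}

/-- `I` is the Cauchy principal value of `∫ f` over the real line, with singularities at the
points of `S`: outside the symmetric `ε`-neighbourhoods of these points `f` is integrable, and its
integrals over what remains converge to `I` as `ε → 0⁺`. -/
def HasPVIntegral (f : ℝ → ℂ) (S : Set ℝ) (I : ℂ) : Prop :=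
  (∀ ε : ℝ, 0 < ε → IntegrableOn f {τ | ∀ s ∈ S, ε < |τ - s|} volume) ∧
    Tendsto (fun ε : ℝ => ∫ τ in {τ | ∀ s ∈ S, ε < |τ - s|}, f τ) (𝓝[>] 0) (𝓝 I)

/-- The sum `∑_{k ≥ 1} Θ(c - k) a_k`, a finite sum since `Θ(c - k) = 0` for `k > c`. -/
noncomputable def cutoffSum (c : ℝ) (a : ℕ → ℂ) : ℂ :=
  ∑ k ∈ Finset.Icc 1 ⌊c⌋₊, (step (c - k) : ℂ) * a k

/-- The polylogarithm `Li_n(z) = ∑_{k ≥ 1} z^k / k^n` in the unit disc `|z| < 1`. -/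
noncomputable def polylog (n : ℕ) (z : ℂ) : ℂ :=
  ∑' k : ℕ, z ^ (k + 1) / ((k : ℂ) + 1) ^ n

end RescaledBernoulli

namespace RescaledBernoulli

/-! Put `w = e^{iθ(τ)}`. The equation of the curve gives `e^{-nτ²} = e^{-n} e^{nw} / w^n`, and `dw =
iθ' w dτ`, so the integrand is `e^{-n}/i` times `K(w) dw` for the meromorphic kernel `K(w) = e^{nw}
/ (w^n x (e^{w/x} - 1))` (`integrand_eq`). Since `Im w = Re θ`, the points `w` form the curve `Re w
= y cot y`, `y = Im w`, climbing from height `-π` to `π`: it comes from the far left, crosses the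
real axis at `1`, and returns to the far left around `0`. The residue of `K` at `0` is `B_n(nx) /
(n! x^n)`, and at the simple poles `p = 2πikx`, `k ≠ 0`, it is `e^{np} / p^n`. Thus `J_n` is `2π
e^{-n}` times the sum of the residues inside, where a pole on the curve counts one half, and solving
for the residue at `0` gives the formulas.

The curve is cut at `|τ| ≤ T` and closed by a vertical segment. The residue theorem for this region
is `hasContourDiff_kernel`, proved without winding numbers: after subtraction of principal parts the
kernel is holomorphic on a disc and has a primitive there; powers other than `w⁻¹` have primitives
too; and each `1 / (w - a)` is integrated by explicit branches of the logarithm. The principal value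
enters only when `a` lies on the curve, where the jump of the logarithm produces `πi` instead of
`2πi`.

In `hasPVIntegral_of_tendsto` the segment moves to the left. There `e^{nw}` kills the kernel as long
as `e^{w/x}` stays away from `1`. For `Re x ≠ 0` this holds because `|Re (w/x)|` is large, and only
finitely many poles count. For `x = iq` the poles are real; segments midway between them are used,
every pole on the negative axis is inside, and their residues sum to the polylogarithm. Finally
`weight_mul` compares `y cot y` with `y cot (arg z)` on a ray to turn "inside the curve" into the
step functions of the statement. -/

/-! ### The steepest descent curve: symmetry, range, monotonicity, continuity -/

theorem theta_spec {τ : ℝ} (hτ : 0 < τ) :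
    theta τ ∈ Omega ∧
      Complex.exp (Complex.I * theta τ) - Complex.I * theta τ = 1 - (τ : ℂ) ^ 2 := by
  rw [theta, dif_pos hτ]
  exact (existsUnique_thetaPlus hτ).choose_spec.1

theorem theta_zero : theta 0 = 0 := by simp [theta]

theorem theta_neg (τ : ℝ) : theta (-τ) = -(starRingEnd ℂ) (theta τ) := by
  rcases lt_trichotomy τ 0 with h | h | h
  · have h1 : 0 < -τ := by linarith
    have h2 : ¬ 0 < τ := by linarith
    simp [theta, h1, h2, h]
  · subst h; simp [theta]
  · have h1 : ¬ 0 < -τ := by linarith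
    have h2 : -τ < 0 := by linarith
    simp [theta, h1, h2, h]

/-- The abscissa `Re θ(τ)`. -/
noncomputable def angle (τ : ℝ) : ℝ := (theta τ).re

/-- The image `e^{iθ(τ)}` of the steepest descent curve. -/
noncomputable def curve (τ : ℝ) : ℂ := Complex.exp (Complex.I * theta τ)

theorem curve_ne_zero (τ : ℝ) : curve τ ≠ 0 := Complex.exp_ne_zero _

theorem angle_neg (τ : ℝ) : angle (-τ) = -angle τ := by simp [angle, theta_neg]

theorem angle_zero : angle 0 = 0 := by simp [angle, theta_zero]

theorem angle_pos {τ : ℝ} (hτ : 0 < τ) : 0 < angle τ := (theta_spec hτ).1.1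

theorem angle_lt_pi_of_pos {τ : ℝ} (hτ : 0 < τ) : angle τ < Real.pi := (theta_spec hτ).1.2.1

theorem height_angle {τ : ℝ} (hτ : 0 < τ) : height (angle τ) = 1 - τ ^ 2 :=
  ((mem_Omega_and_eq_iff τ (theta τ)).1 (theta_spec hτ)).2.2.2

theorem curve_neg (τ : ℝ) : curve (-τ) = (starRingEnd ℂ) (curve τ) := by
  rw [curve, curve, theta_neg, ← Complex.exp_conj]
  simp

theorem curve_zero : curve 0 = 1 := by simp [curve, theta_zero]

theorem curve_sub_theta (τ : ℝ) : curve τ - Complex.I * theta τ = 1 - (τ : ℂ) ^ 2 := by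
  rcases lt_trichotomy τ 0 with h | h | h
  · have h1 := (theta_spec (neg_pos.2 h)).2
    have h2 := congrArg (starRingEnd ℂ) h1
    rw [map_sub, ← curve, ← curve_neg, neg_neg, map_mul, Complex.conj_I] at h2
    have h3 := theta_neg (-τ)
    rw [neg_neg] at h3
    rw [h3]
    simp only [map_sub, map_one, map_pow, Complex.conj_ofReal] at h2
    push_cast at h2
    linear_combination h2
  · subst h; simp [curve_zero, theta_zero]
  · exact (theta_spec h).2

theorem curve_im (τ : ℝ) : (curve τ).im = angle τ := by
  have h := congrArg Complex.im (curve_sub_theta τ)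
  simp [pow_two] at h
  rw [angle]; linarith

/-- The limit `1` at the origin alone gives a weak inequality; it is applied at `X / 2`, and strict
monotonicity from `X / 2` to `X` supplies the strictness. -/
theorem height_lt_one {X : ℝ} (hX : X ∈ Set.Ioo 0 Real.pi) : height X < 1 := by
  have h2 : X / 2 ∈ Set.Ioo 0 Real.pi := ⟨by linarith [hX.1], by linarith [hX.1, hX.2]⟩
  have h1 : height X < height (X / 2) := height_strictAntiOn h2 hX (by linarith [hX.1])
  refine h1.trans_le (ge_of_tendsto tendsto_height_zero ?_)
  filter_upwards [Ioo_mem_nhdsGT h2.1] with y hy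
  exact (height_strictAntiOn ⟨hy.1, hy.2.trans h2.2⟩ h2 hy.2).le

theorem exists_angle_eq_of_pos {X : ℝ} (hX : X ∈ Set.Ioo 0 Real.pi) : ∃ τ, 0 < τ ∧ angle τ = X := by
  have h := height_lt_one hX
  have h0 : 0 < √(1 - height X) := Real.sqrt_pos.2 (by linarith)
  refine ⟨√(1 - height X), h0, ?_⟩
  refine height_strictAntiOn.injOn ⟨angle_pos h0, angle_lt_pi_of_pos h0⟩ hX ?_
  rw [height_angle h0, Real.sq_sqrt (by linarith)]
  ring

theorem exists_angle_eq {X : ℝ} (hX : X ∈ Set.Ioo (-Real.pi) Real.pi) : ∃ τ, angle τ = X := by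
  rcases lt_trichotomy X 0 with h | h | h
  · obtain ⟨τ, -, hτ⟩ := exists_angle_eq_of_pos (X := -X) ⟨by linarith, by linarith [hX.1]⟩
    exact ⟨-τ, by rw [angle_neg, hτ, neg_neg]⟩
  · exact ⟨0, by rw [angle_zero, h]⟩
  · obtain ⟨τ, -, hτ⟩ := exists_angle_eq_of_pos (X := X) ⟨h, hX.2⟩
    exact ⟨τ, hτ⟩

theorem angle_strictMono : StrictMono angle := by
  have hpos : ∀ a b : ℝ, 0 < a → a < b → angle a < angle b := by
    intro a b ha hab
    have hb := ha.trans hab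
    by_contra! hc
    have := height_strictAntiOn.antitoneOn ⟨angle_pos hb, angle_lt_pi_of_pos hb⟩
      ⟨angle_pos ha, angle_lt_pi_of_pos ha⟩ hc
    rw [height_angle ha, height_angle hb] at this
    nlinarith
  have hneg : ∀ a : ℝ, a < 0 → angle a < 0 := fun a ha => by
    have := angle_pos (neg_pos.2 ha)
    rw [angle_neg] at this; linarith
  intro a b hab
  rcases lt_trichotomy a 0 with ha | ha | ha
  · rcases lt_trichotomy b 0 with hb | hb | hb
    · have := hpos (-b) (-a) (by linarith) (by linarith)
      rw [angle_neg, angle_neg] at this; linarith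
    · rw [hb, angle_zero]; exact hneg a ha
    · exact (hneg a ha).trans (angle_pos hb)
  · rw [ha, angle_zero]; exact angle_pos (by linarith)
  · exact hpos a b ha hab

theorem angle_lt_pi (τ : ℝ) : angle τ < Real.pi :=
  (angle_strictMono.monotone (le_max_left τ 1)).trans_lt
    (angle_lt_pi_of_pos (lt_max_of_lt_right one_pos))

theorem neg_pi_lt_angle (τ : ℝ) : -Real.pi < angle τ := by
  have := angle_lt_pi (-τ)
  rw [angle_neg] at this; linarith

theorem angle_mem (τ : ℝ) : angle τ ∈ Set.Ioo (-Real.pi) Real.pi :=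
  ⟨neg_pi_lt_angle τ, angle_lt_pi τ⟩

theorem angle_ne_zero {τ : ℝ} (hτ : τ ≠ 0) : angle τ ≠ 0 := fun h =>
  hτ (angle_strictMono.injective (h.trans angle_zero.symm))

/-- A monotone function whose image is an interval has no jumps. This covers `τ = 0` as well, where
the equation for `θ` degenerates and an inverse function argument would fail. -/
theorem continuous_angle : Continuous angle := by
  rw [continuous_iff_continuousAt]
  intro τ
  refine continuousAt_of_monotoneOn_of_image_mem_nhds (s := Set.univ)
    (angle_strictMono.monotone.monotoneOn _) univ_mem ?_
  refine mem_of_superset (Ioo_mem_nhds (neg_pi_lt_angle τ) (angle_lt_pi τ)) fun y hy => ?_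
  obtain ⟨t, ht⟩ := exists_angle_eq hy
  exact ⟨t, Set.mem_univ _, ht⟩

theorem sinc_angle_pos (τ : ℝ) : 0 < Real.sinc (angle τ) := by
  have key : ∀ y : ℝ, 0 < y → y < Real.pi → 0 < Real.sinc y := fun y h0 h1 => by
    rw [Real.sinc_of_ne_zero h0.ne']
    exact div_pos (Real.sin_pos_of_pos_of_lt_pi h0 h1) h0
  rcases lt_trichotomy (angle τ) 0 with h | h | h
  · rw [← neg_neg (angle τ), Real.sinc_neg]
    exact key _ (by linarith) (by linarith [neg_pi_lt_angle τ])
  · simp [h]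
  · exact key _ h (angle_lt_pi τ)

theorem theta_im (τ : ℝ) : (theta τ).im = Real.log (Real.sinc (angle τ)) := by
  have hpos : ∀ t : ℝ, 0 < t → (theta t).im = Real.log (Real.sinc (angle t)) := fun t ht => by
    have h0 := angle_pos ht
    have hs := Real.sin_pos_of_pos_of_lt_pi h0 (angle_lt_pi t)
    rw [((mem_Omega_and_eq_iff t (theta t)).1 (theta_spec ht)).2.2.1, Real.sinc_of_ne_zero h0.ne',
      Real.log_div hs.ne' h0.ne', angle]
  rcases lt_trichotomy τ 0 with h | h | h
  · have h1 := hpos (-τ) (by linarith)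
    rw [theta_neg, angle_neg, Real.sinc_neg] at h1
    simpa using h1
  · subst h; simp [theta_zero, angle_zero]
  · exact hpos τ h

theorem theta_eq (τ : ℝ) :
    theta τ = (angle τ : ℂ) + (Real.log (Real.sinc (angle τ)) : ℂ) * Complex.I := by
  rw [← theta_im]
  apply Complex.ext <;> simp [angle]

theorem continuous_theta : Continuous theta := by
  rw [funext theta_eq]
  have h : Continuous fun τ => Real.log (Real.sinc (angle τ)) :=
    (Real.continuous_sinc.comp continuous_angle).log fun τ => (sinc_angle_pos τ).ne'
  have h1 := continuous_angle
  fun_prop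

theorem continuous_curve : Continuous curve := by
  have := continuous_theta
  unfold curve
  fun_prop

/-! ### The derivative of `θ`, including the saddle point -/

/-- For `τ > 0` the abscissa inverts `X ↦ √(1 - height X)`, whose derivative is nonzero because that
of `height` is strictly negative. -/
theorem differentiableAt_angle_of_pos {τ : ℝ} (hτ : 0 < τ) : DifferentiableAt ℝ angle τ := by
  have h0 := angle_pos hτ
  have hpi := angle_lt_pi τ
  have hs : 0 < Real.sin (angle τ) := Real.sin_pos_of_pos_of_lt_pi h0 hpi
  have hlt := height_lt_one ⟨h0, hpi⟩
  have hd := ((hasDerivAt_height h0 hpi).const_sub 1).sqrt (by linarith)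
  refine (HasDerivAt.of_local_left_inverse continuous_angle.continuousAt hd ?_ ?_).differentiableAt
  · have h1 : 0 < √(1 - height (angle τ)) := Real.sqrt_pos.2 (by linarith)
    have h2 : 0 < ((angle τ - Real.sin (angle τ) * Real.cos (angle τ)) ^ 2
      + Real.sin (angle τ) ^ 4) / (angle τ * Real.sin (angle τ) ^ 2) := by positivity
    rw [neg_neg]
    positivity
  · filter_upwards [lt_mem_nhds hτ] with t ht
    rw [height_angle ht, sub_sub_cancel, Real.sqrt_sq ht.le]

theorem differentiableAt_angle {τ : ℝ} (hτ : τ ≠ 0) : DifferentiableAt ℝ angle τ := by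
  rcases lt_or_gt_of_ne hτ with h | h
  · have h1 : angle = fun t => -angle (-t) := by ext t; rw [angle_neg, neg_neg]
    rw [h1]
    have h2 : DifferentiableAt ℝ angle (-τ) := differentiableAt_angle_of_pos (by linarith)
    exact (h2.comp τ differentiableAt_id.neg).neg
  · exact differentiableAt_angle_of_pos h

theorem differentiableAt_theta {τ : ℝ} (hτ : τ ≠ 0) : DifferentiableAt ℝ theta τ := by
  rw [funext theta_eq]
  have h1 := differentiableAt_angle hτ
  have hne := angle_ne_zero hτ
  have h2 : DifferentiableAt ℝ Real.sinc (angle τ) := by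
    have h3 : DifferentiableAt ℝ (fun y => Real.sin y / y) (angle τ) :=
      Real.differentiableAt_sin.div differentiableAt_id hne
    refine h3.congr_of_eventuallyEq ?_
    filter_upwards [isOpen_ne.mem_nhds hne] with y hy
    exact Real.sinc_of_ne_zero hy
  have h4 : DifferentiableAt ℝ (fun t => Real.log (Real.sinc (angle t))) τ :=
    (h2.comp τ h1).log (sinc_angle_pos τ).ne'
  exact (h1.hasDerivAt.ofReal_comp.add
    (h4.hasDerivAt.ofReal_comp.mul_const Complex.I)).differentiableAt

theorem curve_sub_one_ne_zero {τ : ℝ} (hτ : τ ≠ 0) : curve τ - 1 ≠ 0 := fun h => by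
  have := congrArg Complex.im h
  simp [curve_im] at this
  exact angle_ne_zero hτ this

/-- The derivative of `theta`. -/
noncomputable def thetaDeriv (τ : ℝ) : ℂ :=
  if τ = 0 then (√2 : ℝ) else 2 * Complex.I * τ / (curve τ - 1)

/-- Implicit differentiation of `curve τ - iθ = 1 - τ²` gives `iθ'(curve τ - 1) = -2τ`, and the
factor `curve τ - 1` vanishes only at the saddle. -/
theorem hasDerivAt_theta_of_ne {τ : ℝ} (hτ : τ ≠ 0) : HasDerivAt theta (thetaDeriv τ) τ := by
  have hd := (differentiableAt_theta hτ).hasDerivAt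
  have h1 : HasDerivAt (fun t : ℝ => curve t - Complex.I * theta t)
      (Complex.exp (Complex.I * theta τ) * (Complex.I * deriv theta τ)
        - Complex.I * deriv theta τ) τ :=
    ((hd.const_mul Complex.I).cexp).sub (hd.const_mul Complex.I)
  have h2 : HasDerivAt (fun t : ℝ => (1 : ℂ) - (t : ℂ) ^ 2) (-(2 * τ)) τ := by
    have := ((hasDerivAt_id τ).ofReal_comp.pow 2).const_sub (1 : ℂ)
    simpa using this
  have h3 := h1.unique ((funext curve_sub_theta : (fun t : ℝ => curve t - Complex.I * theta t) = _)
    ▸ h2)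
  refine hd.congr_deriv ?_
  rw [thetaDeriv, if_neg hτ, eq_div_iff (curve_sub_one_ne_zero hτ)]
  rw [← curve] at h3
  linear_combination -Complex.I * h3 + deriv theta τ * (curve τ - 1) * Complex.I_mul_I

/-- `Re (2iτ / (w - 1)) = 2τ Im w / |w - 1|²`, and `Im w = angle τ` has the sign of `τ`. This later
selects the square root at the saddle and shows that the image curve climbs with positive speed. -/
theorem re_thetaDeriv_pos (τ : ℝ) : 0 < (thetaDeriv τ).re := by
  rw [thetaDeriv]
  split_ifs with h
  · simp
  · have h1 : 0 < τ * angle τ := by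
      rcases lt_or_gt_of_ne h with h | h
      · have := angle_strictMono h
        rw [angle_zero] at this
        exact mul_pos_of_neg_of_neg h this
      · exact mul_pos h (angle_pos h)
    have h2 : 0 < Complex.normSq (curve τ - 1) := Complex.normSq_pos.2 (curve_sub_one_ne_zero h)
    rw [Complex.div_re]
    simp [curve_im]
    rw [mul_assoc]
    positivity

theorem tendsto_exp_sub_one_div :
    Tendsto (fun u : ℂ => (Complex.exp u - 1) / u) (𝓝[≠] 0) (𝓝 1) := by
  have := (Complex.hasDerivAt_exp 0).tendsto_slope
  rw [Complex.exp_zero] at this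
  refine this.congr fun u => ?_
  rw [slope_def_field]; simp

/-- At `u = iθ(τ)` the quotient equals `θ'(τ)² / 4`, since `e^u - 1 - u = -τ²`. -/
theorem tendsto_exp_quotient :
    Tendsto (fun u : ℂ => (Complex.exp u - 1 - u) / (Complex.exp u - 1) ^ 2) (𝓝[≠] 0)
      (𝓝 (1 / 2)) := by
  have h1 := tendsto_exp_sub_one_div
  have h2 : Tendsto (fun u : ℂ => (Complex.exp u - 1 - u) / u ^ 2) (𝓝[≠] 0) (𝓝 (1 / 2)) := by
    have h3 : (fun x : ℂ => Complex.exp x - ∑ i ∈ Finset.range 3, x ^ i / (i.factorial : ℂ))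
        =o[𝓝 0] (· ^ 2) := (Complex.exp_sub_sum_range_isBigO_pow 3).trans_isLittleO
          (Asymptotics.isLittleO_pow_pow (by norm_num))
    have h4 := (h3.mono (nhdsWithin_le_nhds (s := {0}ᶜ))).tendsto_div_nhds_zero
    have h5 := h4.add_const (1 / 2 : ℂ)
    rw [zero_add] at h5
    refine h5.congr' ?_
    filter_upwards [self_mem_nhdsWithin] with u hu
    have : u ≠ 0 := hu
    simp [Finset.sum_range_succ, Nat.factorial]
    field_simp
    ring
  have h6 := h2.div (h1.pow 2) (by norm_num)
  rw [one_pow, div_one] at h6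
  refine h6.congr' ?_
  filter_upwards [self_mem_nhdsWithin] with u hu
  have : u ≠ 0 := hu
  simp only [Pi.div_apply]
  field_simp

/-- The expansion at the saddle only determines `θ'² → 2`. As `Re θ' > 0`, the factor `θ' + √2` of
`θ'² - 2` has modulus at least `1`, so the other factor `θ' - √2` tends to `0`. -/
theorem continuousAt_thetaDeriv_zero : ContinuousAt thetaDeriv 0 := by
  have h0 : thetaDeriv 0 = (√2 : ℝ) := by simp [thetaDeriv]
  rw [continuousAt_iff_punctured_nhds, h0]
  have hu : Tendsto (fun τ : ℝ => Complex.I * theta τ) (𝓝[≠] 0) (𝓝[≠] 0) := by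
    refine tendsto_nhdsWithin_iff.2 ⟨?_, ?_⟩
    · have : Continuous fun τ : ℝ => Complex.I * theta τ := continuous_const.mul continuous_theta
      exact (this.tendsto' 0 0 (by simp [theta_zero])).mono_left nhdsWithin_le_nhds
    · filter_upwards [self_mem_nhdsWithin] with τ hτ h
      have h1 : theta τ = 0 := by simpa using h
      exact angle_ne_zero hτ (by simp [angle, h1])
  have h1 := (tendsto_exp_quotient.comp hu).const_mul (4 : ℂ)
  have h2 : Tendsto (fun τ : ℝ => thetaDeriv τ ^ 2) (𝓝[≠] 0) (𝓝 2) := by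
    rw [show (4 : ℂ) * (1 / 2) = 2 by norm_num] at h1
    refine h1.congr' ?_
    filter_upwards [self_mem_nhdsWithin] with τ hτ
    have hτ' : τ ≠ 0 := hτ
    have h3 := curve_sub_theta τ
    have h4 := curve_sub_one_ne_zero hτ'
    rw [thetaDeriv, if_neg hτ', div_pow]
    simp only [Function.comp]
    rw [← curve, ← mul_div_assoc]
    congr 1
    linear_combination 4 * h3 - 4 * (τ : ℂ) ^ 2 * Complex.I_sq
  have hs : ((√2 : ℝ) : ℂ) ^ 2 = 2 := by
    rw [← Complex.ofReal_pow, Real.sq_sqrt (by norm_num)]; norm_num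
  rw [tendsto_iff_norm_sub_tendsto_zero] at h2 ⊢
  refine squeeze_zero (fun _ => norm_nonneg _) (fun τ => ?_) h2
  have h3 : thetaDeriv τ ^ 2 - 2 = (thetaDeriv τ - (√2 : ℝ)) * (thetaDeriv τ + (√2 : ℝ)) := by
    linear_combination hs
  have h4 : (1 : ℝ) ≤ ‖thetaDeriv τ + (√2 : ℝ)‖ := by
    refine le_trans ?_ (Complex.re_le_norm _)
    have := re_thetaDeriv_pos τ
    have h5 : (1 : ℝ) ≤ √2 := Real.one_le_sqrt.2 (by norm_num)
    simp only [Complex.add_re, Complex.ofReal_re]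
    linarith
  rw [h3, norm_mul]
  exact le_mul_of_one_le_right (norm_nonneg _) h4

theorem hasDerivAt_theta (τ : ℝ) : HasDerivAt theta (thetaDeriv τ) τ :=
  hasDerivAt_of_hasDerivAt_of_ne' (fun _ h => hasDerivAt_theta_of_ne h)
    continuous_theta.continuousAt continuousAt_thetaDeriv_zero τ

theorem continuous_thetaDeriv : Continuous thetaDeriv := by
  rw [continuous_iff_continuousAt]
  intro τ
  rcases eq_or_ne τ 0 with rfl | h
  · exact continuousAt_thetaDeriv_zero
  · have h1 : ContinuousAt (fun t : ℝ => 2 * Complex.I * (t : ℂ) / (curve t - 1)) τ := by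
      have := continuous_curve
      exact ContinuousAt.div (by fun_prop) (by fun_prop) (curve_sub_one_ne_zero h)
    refine h1.congr ?_
    filter_upwards [isOpen_ne.mem_nhds h] with t ht
    rw [thetaDeriv, if_neg ht]

/-! ### Geometry of the image curve -/

/-- The derivative of `curve`. -/
noncomputable def curveDeriv (τ : ℝ) : ℂ := Complex.I * thetaDeriv τ * curve τ

theorem hasDerivAt_curve (τ : ℝ) : HasDerivAt curve (curveDeriv τ) τ := by
  have := ((hasDerivAt_theta τ).const_mul Complex.I).cexp
  refine this.congr_deriv ?_
  rw [curveDeriv, curve]; ring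

theorem continuous_curveDeriv : Continuous curveDeriv :=
  (continuous_const.mul continuous_thetaDeriv).mul continuous_curve

theorem im_curveDeriv_pos (τ : ℝ) : 0 < (curveDeriv τ).im := by
  have h1 : HasDerivAt (fun t => (curve t).im) (curveDeriv τ).im τ :=
    Complex.imCLM.hasFDerivAt.comp_hasDerivAt τ (hasDerivAt_curve τ)
  have h2 : HasDerivAt (fun t => (theta t).re) (thetaDeriv τ).re τ :=
    Complex.reCLM.hasFDerivAt.comp_hasDerivAt τ (hasDerivAt_theta τ)
  have h3 : (fun t => (curve t).im) = fun t => (theta t).re := funext curve_im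
  rw [h3] at h1
  rw [h1.unique h2]
  exact re_thetaDeriv_pos τ

theorem curve_injective : Function.Injective curve := fun a b h =>
  angle_strictMono.injective (by rw [← curve_im, ← curve_im, h])

/-- The equation `Re w = y cot y` of the curve, cleared of its denominator. -/
theorem curve_re_mul_sin (τ : ℝ) : (curve τ).re * Real.sin (angle τ)
    = angle τ * Real.cos (angle τ) := by
  have h1 := curve_im τ
  have h2 : (curve τ).re = Real.exp (-(theta τ).im) * Real.cos (angle τ) := by
    simp [curve, Complex.exp_re, angle]
  have h3 : (curve τ).im = Real.exp (-(theta τ).im) * Real.sin (angle τ) := by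
    simp [curve, Complex.exp_im, angle]
  rw [h2]
  linear_combination Real.cos (angle τ) * (h1 - h3)

theorem norm_curve (τ : ℝ) : ‖curve τ‖ = Real.exp (-(theta τ).im) := by
  rw [curve, Complex.norm_exp]; simp

theorem one_le_norm_curve (τ : ℝ) : 1 ≤ ‖curve τ‖ := by
  rw [norm_curve, theta_im, Real.one_le_exp_iff, neg_nonneg]
  exact Real.log_nonpos (sinc_angle_pos τ).le (Real.sinc_le_one _)

theorem curve_re_neg (τ : ℝ) : (curve (-τ)).re = (curve τ).re := by simp [curve_neg]

theorem curve_re_abs (τ : ℝ) : (curve |τ|).re = (curve τ).re := by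
  rcases abs_cases τ with h | h
  · rw [h.1]
  · rw [h.1, curve_re_neg]

/-- `dw/dτ = -2τ w / (w - 1)`, and `Re (w / (w - 1)) = (|w|² - Re w) / |w - 1|²` is positive because
`|w| ≥ 1` and `Im w > 0`. Hence a vertical line truncates the curve exactly at some `|τ| ≤ T`. -/
theorem curve_re_strictAntiOn : StrictAntiOn (fun τ => (curve τ).re) (Set.Ici 0) := by
  have hd : ∀ τ, HasDerivAt (fun t => (curve t).re) (curveDeriv τ).re τ := fun τ =>
    Complex.reCLM.hasFDerivAt.comp_hasDerivAt τ (hasDerivAt_curve τ)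
  refine strictAntiOn_of_deriv_neg (convex_Ici _)
    (fun τ _ => (hd τ).continuousAt.continuousWithinAt) fun τ hτ => ?_
  rw [interior_Ici] at hτ
  have h0 : 0 < τ := hτ
  rw [(hd τ).deriv]
  have h1 : curveDeriv τ = ((-2 * τ : ℝ) : ℂ) * (curve τ / (curve τ - 1)) := by
    rw [curveDeriv, thetaDeriv, if_neg h0.ne']
    push_cast
    linear_combination 2 * (τ : ℂ) * curve τ / (curve τ - 1) * Complex.I_mul_I
  have h2 : 0 < Complex.normSq (curve τ - 1) :=
    Complex.normSq_pos.2 (curve_sub_one_ne_zero h0.ne')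
  have h3 : 0 < (curve τ / (curve τ - 1)).re := by
    have h4 : (curve τ / (curve τ - 1)).re =
        ((curve τ).re ^ 2 + (curve τ).im ^ 2 - (curve τ).re) / Complex.normSq (curve τ - 1) := by
      rw [Complex.div_re]; simp; ring
    rw [h4]
    refine div_pos ?_ h2
    have h5 : 1 ≤ (curve τ).re ^ 2 + (curve τ).im ^ 2 := by
      have h6 := one_le_norm_curve τ
      have h7 := Complex.sq_norm (curve τ)
      rw [Complex.normSq_apply] at h7
      nlinarith
    have h6 : 0 < (curve τ).im := by rw [curve_im]; exact angle_pos h0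
    nlinarith [sq_nonneg ((curve τ).re - 1)]
  rw [h1, Complex.re_ofReal_mul]
  nlinarith

theorem curve_re_lt_of_abs_lt {σ T : ℝ} (h : |σ| < T) : (curve T).re < (curve σ).re := by
  rw [← curve_re_abs σ]
  exact curve_re_strictAntiOn (abs_nonneg σ) ((abs_nonneg σ).trans h.le) h

theorem curve_re_le_of_abs_le {σ T : ℝ} (h : |σ| ≤ T) : (curve T).re ≤ (curve σ).re := by
  rw [← curve_re_abs σ]
  exact curve_re_strictAntiOn.antitoneOn (abs_nonneg σ) ((abs_nonneg σ).trans h) h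

theorem abs_lt_of_curve_re_lt {σ T : ℝ} (hT : 0 ≤ T) (h : (curve T).re < (curve σ).re) :
    |σ| < T := by
  by_contra! hc
  have := curve_re_strictAntiOn.antitoneOn hT (abs_nonneg σ) hc
  simp only [curve_re_abs] at this
  linarith

theorem curve_re_le_one (τ : ℝ) : (curve τ).re ≤ 1 := by
  have := curve_re_le_of_abs_le (σ := 0) (T := |τ|) (by simp)
  simpa [curve_re_abs, curve_zero] using this

theorem abs_curve_im_lt (τ : ℝ) : |(curve τ).im| < Real.pi := by
  rw [curve_im]; exact abs_lt.2 (angle_mem τ)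

/-- The real part of the curve equation reads `τ² = 1 - Re w + log |w|`, and `log |w| ≤ |w|` with
`|Im w| < π`. So `Re w` is unbounded as `τ` grows. -/
theorem sq_le_curve_re (τ : ℝ) : τ ^ 2 ≤ 1 + Real.pi + 2 * |(curve τ).re| := by
  have h := congrArg Complex.re (curve_sub_theta τ)
  simp [pow_two] at h
  have h1 : -(theta τ).im ≤ ‖curve τ‖ := by
    rw [norm_curve]; linarith [Real.add_one_le_exp (-(theta τ).im)]
  have h2 := Complex.norm_le_abs_re_add_abs_im (curve τ)
  have h3 := abs_curve_im_lt τ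
  have h4 := neg_abs_le (curve τ).re
  linarith

theorem tendsto_curve_re : Tendsto (fun τ => (curve τ).re) atTop atBot := by
  rw [tendsto_atBot]
  intro b
  have h1 : Tendsto (fun τ : ℝ => τ ^ 2) atTop atTop := tendsto_pow_atTop (by norm_num)
  filter_upwards [h1.eventually_gt_atTop (1 + Real.pi + 2 * (1 + |b|))] with τ hτ
  have h2 := sq_le_curve_re τ
  have h3 := curve_re_le_one τ
  have h4 := neg_abs_le b
  rcases abs_cases (curve τ).re with h | h <;> linarith [abs_nonneg b]

theorem curve_eq_mk (τ : ℝ) : curve τ = (curve τ).re + (angle τ : ℝ) * Complex.I := by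
  rw [← curve_im, Complex.re_add_im]

/-! ### Keeping `e^{w/x}` away from `1` far to the left -/

/-- A lower bound of `|e^u - 1|` in terms of `|Re u|`. -/
theorem le_norm_exp_sub_one (u : ℂ) : 1 - Real.exp (-|u.re|) ≤ ‖Complex.exp u - 1‖ := by
  have h1 := abs_norm_sub_norm_le (Complex.exp u) 1
  rw [Complex.norm_exp, norm_one] at h1
  refine le_trans ?_ h1
  rcases abs_cases u.re with h | h
  · rw [h.1]
    refine le_trans ?_ (le_abs_self _)
    have h2 := Real.add_one_le_exp u.re
    have h3 := Real.add_one_le_exp (-u.re)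
    linarith [h.2]
  · rw [h.1, neg_neg]
    refine le_trans ?_ (neg_le_abs _)
    linarith

theorem div_re_mul_normSq (w x : ℂ) (hx : x ≠ 0) :
    (w / x).re * Complex.normSq x = w.re * x.re + w.im * x.im := by
  have : Complex.normSq x ≠ 0 := (Complex.normSq_pos.2 hx).ne'
  rw [Complex.div_re]; field_simp

/-- In `|x|² Re (w/x) = Re w Re x + Im w Im x` the last term is bounded on the strip, while the
first one grows with `|Re w|`. -/
theorem exists_forall_re_ge {x : ℂ} (hx : x.re ≠ 0) (M : ℝ) :
    ∃ R : ℝ, ∀ w : ℂ, w.re ≤ R → |w.im| ≤ Real.pi → M ≤ |(w / x).re| := by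
  have hx0 : x ≠ 0 := fun h => hx (by simp [h])
  have hN := Complex.normSq_pos.2 hx0
  refine ⟨-((|M| * Complex.normSq x + Real.pi * |x.im|) / |x.re|), fun w h1 h2 => ?_⟩
  have h3 : 0 < |x.re| := abs_pos.2 hx
  have h4 : (|M| * Complex.normSq x + Real.pi * |x.im|) / |x.re| ≤ |w.re| := by
    have := neg_le_abs w.re; linarith
  rw [div_le_iff₀ h3] at h4
  have h5 := congrArg abs (div_re_mul_normSq w x hx0)
  rw [abs_mul, abs_of_pos hN] at h5
  have h6 : |w.re * x.re| - |w.im * x.im| ≤ |w.re * x.re + w.im * x.im| := by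
    have := abs_sub_abs_le_abs_sub (w.re * x.re) (-(w.im * x.im))
    rwa [abs_neg, sub_neg_eq_add] at this
  rw [abs_mul, abs_mul] at h6
  have h7 : |w.im| * |x.im| ≤ Real.pi * |x.im| := by gcongr
  have h8 : |M| * Complex.normSq x ≤ |(w / x).re| * Complex.normSq x := by linarith
  exact (le_abs_self M).trans (le_of_mul_le_mul_right h8 hN)

/-- If `Re x = 0`, then `|Re (w/x)|` is proportional to `|Im w|`, which is bounded below away from
`τ = 0`; otherwise it is large because `Re w → -∞`. In both cases the ends of the curve avoid the
poles. -/
theorem exists_le_norm_exp_curve_sub_one {x : ℂ} (hx : x ≠ 0) :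
    ∃ δ > 0, ∃ T : ℝ, ∀ τ, T ≤ |τ| → δ ≤ ‖Complex.exp (curve τ / x) - 1‖ := by
  suffices h : ∃ δ > 0, ∃ T : ℝ, ∀ τ, T ≤ |τ| → δ ≤ |(curve τ / x).re| by
    obtain ⟨δ, hδ, T, h⟩ := h
    refine ⟨1 - Real.exp (-δ), ?_, T, fun τ hτ => le_trans ?_ (le_norm_exp_sub_one _)⟩
    · have : Real.exp (-δ) < 1 := by rw [Real.exp_lt_one_iff]; linarith
      linarith
    · have := Real.exp_le_exp.2 (neg_le_neg (h τ hτ)); linarith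
  by_cases hre : x.re = 0
  · have him : x.im ≠ 0 := fun h => hx (Complex.ext hre h)
    have hN := Complex.normSq_pos.2 hx
    obtain ⟨T, hT0, hT⟩ := exists_angle_eq_of_pos (X := 1) ⟨one_pos, by linarith [Real.pi_gt_three]⟩
    refine ⟨|x.im| / Complex.normSq x, div_pos (abs_pos.2 him) hN, T, fun τ hτ => ?_⟩
    have h1 := congrArg abs (div_re_mul_normSq (curve τ) x hx)
    rw [abs_mul, abs_of_pos hN, hre, mul_zero, zero_add, abs_mul] at h1
    rw [div_le_iff₀ hN, h1]
    refine le_mul_of_one_le_left (abs_nonneg _) ?_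
    rw [curve_im]
    have h2 : 1 ≤ angle |τ| := hT ▸ angle_strictMono.monotone hτ
    rcases abs_cases τ with h | h
    · rw [h.1] at h2; exact h2.trans (le_abs_self _)
    · rw [h.1, angle_neg] at h2; exact h2.trans (neg_le_abs _)
  · obtain ⟨R, hR⟩ := exists_forall_re_ge hre 1
    obtain ⟨T, hT⟩ := (tendsto_curve_re.eventually_le_atBot R).exists_forall_of_atTop
    refine ⟨1, one_pos, T, fun τ hτ => hR _ ?_ (abs_curve_im_lt τ).le⟩
    rw [← curve_re_abs]; exact hT _ hτ

/-! ### The meromorphic kernel, its poles, and the size of the integrand -/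

/-- The poles `2πikx` of `1 / g(w / x)`. -/
noncomputable def pole (x : ℂ) (k : ℤ) : ℂ := 2 * Real.pi * Complex.I * k * x

theorem exp_div_eq_one_iff {x w : ℂ} (hx : x ≠ 0) :
    Complex.exp (w / x) = 1 ↔ ∃ k : ℤ, w = pole x k := by
  rw [Complex.exp_eq_one_iff]
  refine exists_congr fun k => ?_
  rw [div_eq_iff hx, pole]
  constructor <;> intro h <;> rw [h] <;> ring

theorem norm_pole (x : ℂ) (k : ℤ) : ‖pole x k‖ = 2 * Real.pi * ‖x‖ * |(k : ℝ)| := by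
  simp [pole, abs_of_pos Real.pi_pos]
  ring

theorem pole_injective {x : ℂ} (hx : x ≠ 0) : Function.Injective (pole x) := by
  intro a b h
  have h2 : (2 * Real.pi * Complex.I * x : ℂ) ≠ 0 := by
    simp [hx, Real.pi_ne_zero]
  have h1 : (2 * Real.pi * Complex.I * x) * (a : ℂ) = (2 * Real.pi * Complex.I * x) * (b : ℂ) := by
    simp only [pole] at h
    linear_combination h
  exact_mod_cast mul_left_cancel₀ h2 h1

theorem pole_ne_zero {x : ℂ} (hx : x ≠ 0) {k : ℤ} (hk : k ≠ 0) : pole x k ≠ 0 := by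
  simp [pole, hx, Real.pi_ne_zero, hk]

theorem g_div_of_ne_zero {w x : ℂ} (hw : w ≠ 0) (hx : x ≠ 0) :
    g (w / x) = x * (Complex.exp (w / x) - 1) / w := by
  rw [g, if_neg (div_ne_zero hw hx)]
  field_simp

theorem mem_singularSet_iff {x : ℂ} (hx : x ≠ 0) (τ : ℝ) :
    τ ∈ singularSet x ↔ Complex.exp (curve τ / x) = 1 := by
  rw [singularSet, Set.mem_ofPred_eq, ← curve, g_div_of_ne_zero (curve_ne_zero τ) hx]
  simp [hx, curve_ne_zero, sub_eq_zero]

/-- The meromorphic function `e^{nw} / (w^{n+1} g(w/x))`. -/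
noncomputable def kernel (n : ℕ) (x w : ℂ) : ℂ :=
  Complex.exp (n * w) / (w ^ n * (x * (Complex.exp (w / x) - 1)))

/-- The change of variables `w = e^{iθ(τ)}`: the Gaussian becomes `e^{-n} e^{nw} / w^n` by the curve
equation. -/
theorem integrand_eq {n : ℕ} {x : ℂ} (hx : x ≠ 0) (τ : ℝ) :
    integrand n x τ =
      Complex.exp (-n) / Complex.I * (kernel n x (curve τ) * curveDeriv τ) := by
  have h0 := curve_ne_zero τ
  have h1 : Complex.exp (-(n : ℂ) * (τ : ℂ) ^ 2)
      = Complex.exp (-n) * Complex.exp (n * curve τ) / curve τ ^ n := by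
    have h2 : curve τ ^ n = Complex.exp (n * (Complex.I * theta τ)) := by
      rw [curve, ← Complex.exp_nat_mul]
    rw [h2, ← Complex.exp_add, ← Complex.exp_sub]
    congr 1
    linear_combination (-(n : ℂ)) * curve_sub_theta τ
  rw [integrand, h1, (hasDerivAt_theta τ).deriv, ← curve, g_div_of_ne_zero h0 hx, kernel,
    curveDeriv]
  -- At a singular point both sides are `0`, by the convention for division by zero.
  by_cases h : Complex.exp (curve τ / x) - 1 = 0
  · simp [h]
  · field_simp

theorem continuousAt_kernel {n : ℕ} {x w : ℂ} (hx : x ≠ 0) (hw : w ≠ 0)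
    (h : Complex.exp (w / x) ≠ 1) : ContinuousAt (kernel n x) w := by
  unfold kernel
  refine ContinuousAt.div (by fun_prop) (by fun_prop) ?_
  exact mul_ne_zero (pow_ne_zero _ hw) (mul_ne_zero hx (sub_ne_zero.2 h))

theorem continuousAt_integrand {n : ℕ} {x : ℂ} (hx : x ≠ 0) {τ : ℝ} (h : τ ∉ singularSet x) :
    ContinuousAt (integrand n x) τ := by
  rw [mem_singularSet_iff hx] at h
  rw [funext (integrand_eq (n := n) hx)]
  exact continuousAt_const.mul
    ((ContinuousAt.comp (f := curve) (continuousAt_kernel hx (curve_ne_zero τ) h)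
      continuous_curve.continuousAt).mul continuous_curveDeriv.continuousAt)

theorem exists_singularSet_bound {x : ℂ} (hx : x ≠ 0) :
    ∃ T : ℝ, ∀ τ ∈ singularSet x, |τ| < T := by
  obtain ⟨δ, hδ, T, h⟩ := exists_le_norm_exp_curve_sub_one hx
  refine ⟨T, fun τ hτ => ?_⟩
  by_contra! hc
  have := h τ hc
  rw [(mem_singularSet_iff hx τ).1 hτ, sub_self, norm_zero] at this
  linarith

theorem finite_pole_norm_le {x : ℂ} (hx : x ≠ 0) (C : ℝ) : {k : ℤ | ‖pole x k‖ ≤ C}.Finite := by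
  have hp : 0 < 2 * Real.pi * ‖x‖ := by have := norm_pos_iff.2 hx; positivity
  refine (Set.finite_Icc (-⌈C / (2 * Real.pi * ‖x‖)⌉) ⌈C / (2 * Real.pi * ‖x‖)⌉).subset
    fun k hk => ?_
  have h1 : 2 * Real.pi * ‖x‖ * |(k : ℝ)| ≤ C := norm_pole x k ▸ hk
  have h2 : |(k : ℝ)| ≤ C / (2 * Real.pi * ‖x‖) := by rw [le_div_iff₀ hp]; linarith
  have h3 : |(k : ℝ)| ≤ (⌈C / (2 * Real.pi * ‖x‖)⌉ : ℝ) := h2.trans (Int.le_ceil _)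
  have h4 : |k| ≤ ⌈C / (2 * Real.pi * ‖x‖)⌉ := by exact_mod_cast h3
  exact abs_le.1 h4

theorem finite_singularSet {x : ℂ} (hx : x ≠ 0) : (singularSet x).Finite := by
  obtain ⟨T, hT⟩ := exists_singularSet_bound hx
  obtain ⟨C, hC⟩ := (isCompact_Icc (a := -T) (b := T)).exists_bound_of_continuousOn
    continuous_curve.continuousOn
  have h1 : singularSet x ⊆ curve ⁻¹' (pole x '' {k : ℤ | ‖pole x k‖ ≤ C}) := fun τ hτ => by
    obtain ⟨k, hk⟩ := (exp_div_eq_one_iff hx).1 ((mem_singularSet_iff hx τ).1 hτ)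
    refine ⟨k, ?_, hk.symm⟩
    rw [Set.mem_ofPred_eq, ← hk]
    exact hC τ (abs_le.1 (hT τ hτ).le)
  exact (((finite_pole_norm_le hx C).image _).preimage curve_injective.injOn).subset h1

/-- Far out `|θ'| = 2|τ| / |w - 1|` and `|1/g| ≤ |w| / (|x| δ)`. The growth of `w` cancels since
`|w| ≤ 2|w - 1|` once `Re w ≤ -2`, and a Gaussian times `|τ|` remains. -/
theorem exists_norm_integrand_le {n : ℕ} (hn : 1 ≤ n) {x : ℂ} (hx : x ≠ 0) :
    ∃ C T : ℝ, ∀ τ, T ≤ |τ| → ‖integrand n x τ‖ ≤ C * |τ * Real.exp (-1 * τ ^ 2)| := by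
  obtain ⟨δ, hδ, T, hT⟩ := exists_le_norm_exp_curve_sub_one hx
  obtain ⟨T', hT'⟩ := (tendsto_curve_re.eventually_le_atBot (-2)).exists_forall_of_atTop
  have hx' := norm_pos_iff.2 hx
  refine ⟨4 / (‖x‖ * δ), max 1 (max T T'), fun τ hτ => ?_⟩
  have h1 := hT τ ((le_max_left T T').trans ((le_max_right _ _).trans hτ))
  have h2 := hT' |τ| ((le_max_right T T').trans ((le_max_right _ _).trans hτ))
  have h3 : τ ≠ 0 := by
    rintro rfl
    have := (le_max_left 1 (max T T')).trans hτ
    simp at this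
    linarith
  rw [curve_re_abs] at h2
  have h4 : 2 ≤ ‖curve τ‖ := by
    have := Complex.abs_re_le_norm (curve τ)
    have h5 := neg_le_abs (curve τ).re
    linarith
  have h5 : ‖curve τ‖ ≤ 2 * ‖curve τ - 1‖ := by
    have := norm_sub_norm_le (curve τ) 1
    rw [norm_one] at this
    linarith
  have h6 : 0 < ‖curve τ - 1‖ := by linarith
  have h7 : ‖Complex.exp (-(n : ℂ) * (τ : ℂ) ^ 2)‖ ≤ Real.exp (-1 * τ ^ 2) := by
    rw [Complex.norm_exp, Real.exp_le_exp]
    have h8 : -(n : ℂ) * (τ : ℂ) ^ 2 = ((-(n : ℝ) * τ ^ 2 : ℝ) : ℂ) := by push_cast; ring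
    rw [h8, Complex.ofReal_re]
    have : (1 : ℝ) ≤ n := by exact_mod_cast hn
    nlinarith [sq_nonneg τ]
  have h8 : 0 < ‖Complex.exp (curve τ / x) - 1‖ := hδ.trans_le h1
  rw [integrand, (hasDerivAt_theta τ).deriv, ← curve, g_div_of_ne_zero (curve_ne_zero τ) hx,
    thetaDeriv, if_neg h3]
  simp only [norm_div, norm_mul, Complex.norm_I, Complex.norm_two, Complex.norm_real,
    Real.norm_eq_abs, abs_mul, Real.abs_exp]
  calc _ ≤ Real.exp (-1 * τ ^ 2) * (2 * 1 * |τ| / ‖curve τ - 1‖)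
        / (‖x‖ * δ / (2 * ‖curve τ - 1‖)) := by
        have : 0 < ‖curve τ‖ := by linarith
        gcongr
    _ = _ := by field_simp; ring

/-! ### Principal values with finitely many excluded points -/

/-- The real line without the symmetric `ε`-neighbourhoods of the points of `S`. -/
def awayFrom (S : Set ℝ) (ε : ℝ) : Set ℝ := {τ | ∀ s ∈ S, ε < |τ - s|}

theorem measurableSet_awayFrom {S : Set ℝ} (hS : S.Finite) (ε : ℝ) :
    MeasurableSet (awayFrom S ε) := by
  have : awayFrom S ε = ⋂ s ∈ S, {τ | ε < |τ - s|} := by ext; simp [awayFrom]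
  rw [this]
  exact hS.measurableSet_biInter fun s _ =>
    measurableSet_lt measurable_const (by fun_prop)

theorem integrableOn_awayFrom_Icc {S : Set ℝ} {f : ℝ → ℂ} {ε : ℝ} (hε : 0 < ε) (a b : ℝ)
    (hf : ∀ τ ∈ Set.Icc a b, τ ∉ S → ContinuousAt f τ) :
    IntegrableOn f (awayFrom S ε ∩ Set.Icc a b) := by
  have hc : IsClosed (⋂ s ∈ S, {τ : ℝ | ε ≤ |τ - s|}) :=
    isClosed_biInter fun s _ => isClosed_le continuous_const (by fun_prop)
  have h1 : ContinuousOn f (Set.Icc a b ∩ ⋂ s ∈ S, {τ : ℝ | ε ≤ |τ - s|}) := fun τ hτ => by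
    refine (hf τ hτ.1 fun hS => ?_).continuousWithinAt
    have := Set.mem_iInter₂.1 hτ.2 τ hS
    simp at this
    linarith
  refine (h1.integrableOn_compact (isCompact_Icc.inter_right hc)).mono_set fun τ hτ => ?_
  exact ⟨hτ.2, Set.mem_iInter₂.2 fun s hs => (hτ.1 s hs).le⟩

theorem integrableOn_integrand_tail {n : ℕ} (hn : 1 ≤ n) {x : ℂ} (hx : x ≠ 0) :
    ∃ T : ℝ, IntegrableOn (integrand n x) (Set.Icc (-T) T)ᶜ ∧ ∀ τ ∈ singularSet x, |τ| < T := by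
  obtain ⟨C, T, hT⟩ := exists_norm_integrand_le hn hx
  obtain ⟨T', hT'⟩ := exists_singularSet_bound hx
  refine ⟨max T T', ?_, fun τ hτ => (hT' τ hτ).trans_le (le_max_right _ _)⟩
  have hmem : ∀ τ ∈ (Set.Icc (-(max T T')) (max T T'))ᶜ, max T T' < |τ| := fun τ hτ => by
    by_contra! hc
    exact hτ (abs_le.1 hc)
  have h1 : Integrable fun τ : ℝ => C * |τ * Real.exp (-1 * τ ^ 2)| :=
    (integrable_mul_exp_neg_mul_sq one_pos).abs.const_mul C
  refine Integrable.mono' h1.integrableOn ?_ ?_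
  · refine ContinuousOn.aestronglyMeasurable (fun τ hτ => ?_) measurableSet_Icc.compl
    refine (continuousAt_integrand hx fun h => ?_).continuousWithinAt
    linarith [hmem τ hτ, hT' τ h, le_max_right T T']
  · refine (ae_restrict_iff' measurableSet_Icc.compl).2 (ae_of_all _ fun τ hτ => ?_)
    exact hT τ ((le_max_left _ _).trans (hmem τ hτ).le)

theorem integrableOn_integrand_awayFrom {n : ℕ} (hn : 1 ≤ n) {x : ℂ} (hx : x ≠ 0) {ε : ℝ}
    (hε : 0 < ε) : IntegrableOn (integrand n x) (awayFrom (singularSet x) ε) := by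
  obtain ⟨T, hT, -⟩ := integrableOn_integrand_tail hn hx
  have h1 := integrableOn_awayFrom_Icc (S := singularSet x) hε (-T) T
    fun τ _ hτ => continuousAt_integrand (n := n) hx hτ
  refine (h1.union hT).mono_set fun τ hτ => ?_
  by_cases h : τ ∈ Set.Icc (-T) T
  · exact Or.inl ⟨hτ, h⟩
  · exact Or.inr h

theorem tendsto_setIntegral_awayFrom {S B : Set ℝ} (hS : S.Finite) {φ : ℝ → ℂ}
    (hφ : IntegrableOn φ B) :
    Tendsto (fun ε : ℝ => ∫ τ in awayFrom S ε ∩ B, φ τ) (𝓝[>] 0) (𝓝 (∫ τ in B, φ τ)) := by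
  have h1 : ∀ ε, ∫ τ in awayFrom S ε ∩ B, φ τ = ∫ τ in B, (awayFrom S ε).indicator φ τ := fun ε => by
    rw [setIntegral_indicator (measurableSet_awayFrom hS ε), Set.inter_comm]
  simp_rw [h1]
  refine tendsto_integral_filter_of_dominated_convergence (fun τ => ‖φ τ‖) ?_ ?_ hφ.norm ?_
  · exact Eventually.of_forall fun ε =>
      hφ.aestronglyMeasurable.indicator (measurableSet_awayFrom hS ε)
  · exact Eventually.of_forall fun ε => ae_of_all _ fun τ => norm_indicator_le_norm_self _ _
  · have h2 : ∀ᵐ τ ∂(volume.restrict B), τ ∉ S :=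
      ae_restrict_of_ae (measure_eq_zero_iff_ae_notMem.1 (hS.measure_zero _))
    filter_upwards [h2] with τ hτ
    refine tendsto_const_nhds.congr' ?_
    have h3 : ∀ᶠ ε in 𝓝[>] (0 : ℝ), ∀ s ∈ S, ε < |τ - s| := by
      rw [hS.eventually_all]
      intro s hs
      have : 0 < |τ - s| := abs_pos.2 (sub_ne_zero.2 fun h => hτ (h ▸ hs))
      exact (eventually_lt_nhds this).filter_mono nhdsWithin_le_nhds
    filter_upwards [h3] with ε hε
    rw [Set.indicator_of_mem]
    exact hε

theorem awayFrom_mono {S S' : Set ℝ} (h : S ⊆ S') (ε : ℝ) : awayFrom S' ε ⊆ awayFrom S ε :=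
  fun _ hτ s hs => hτ s (h hs)

/-- Excluding the neighbourhoods of further points, at which the integrand is regular, does not
change a principal value. -/
theorem tendsto_setIntegral_awayFrom_of_singleton {S : Set ℝ} (hS : S.Finite) {s a b : ℝ}
    (hs : s ∈ S) {φ : ℝ → ℂ} (hφ : ∀ τ ∈ Set.Icc a b, τ ≠ s → ContinuousAt φ τ) {L : ℂ}
    (h : Tendsto (fun ε : ℝ => ∫ τ in awayFrom {s} ε ∩ Set.Icc a b, φ τ) (𝓝[>] 0) (𝓝 L)) :
    Tendsto (fun ε : ℝ => ∫ τ in awayFrom S ε ∩ Set.Icc a b, φ τ) (𝓝[>] 0) (𝓝 L) := by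
  -- For `ε < δ` the excluded intervals around the other points do not reach `|τ - s| ≤ δ / 2`, so
  -- near `s` excluding `S` or only `s` is the same.
  obtain ⟨δ, hδ, hsep⟩ : ∃ δ > 0, ∀ s' ∈ S, s' ≠ s → 2 * δ ≤ |s' - s| := by
    have h1 : ∀ᶠ δ in 𝓝[>] (0 : ℝ), ∀ s' ∈ S, s' ≠ s → 2 * δ ≤ |s' - s| := by
      rw [hS.eventually_all]
      intro s' _
      by_cases hne : s' = s
      · exact Eventually.of_forall fun _ h => absurd hne h
      · have : 0 < |s' - s| / 2 := half_pos (abs_pos.2 (sub_ne_zero.2 hne))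
        filter_upwards [(eventually_lt_nhds this).filter_mono nhdsWithin_le_nhds] with δ hδ _
        linarith
    obtain ⟨δ, h2, h3⟩ := (h1.and self_mem_nhdsWithin).exists
    exact ⟨δ, h3, h2⟩
  -- On `B` the function is integrable, so both exclusions have the same limit there by dominated
  -- convergence.
  set B : Set ℝ := awayFrom {s} (δ / 2) ∩ Set.Icc a b with hB
  have hBm : MeasurableSet B := (measurableSet_awayFrom (Set.finite_singleton s) _).inter
    measurableSet_Icc
  have hBi : IntegrableOn φ B := integrableOn_awayFrom_Icc (half_pos hδ) a b
    fun τ h1 h2 => hφ τ h1 h2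
  have h1 := (tendsto_setIntegral_awayFrom hS hBi).sub
    (tendsto_setIntegral_awayFrom (Set.finite_singleton s) hBi)
  rw [sub_self] at h1
  have h2 := h1.add h
  rw [zero_add] at h2
  refine h2.congr' ?_
  filter_upwards [self_mem_nhdsWithin, (eventually_lt_nhds hδ).filter_mono nhdsWithin_le_nhds]
    with ε hε0 hεδ
  have hε : 0 < ε := hε0
  have key : ∀ S' : Set ℝ, S'.Finite → s ∈ S' → S' ⊆ S →
      ∫ τ in awayFrom S' ε ∩ Set.Icc a b, φ τ = (∫ τ in awayFrom S' ε ∩ B, φ τ) +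
        ∫ τ in (awayFrom {s} ε ∩ Set.Icc a b) \ B, φ τ := by
    intro S' hS' hs' hsub
    have hi : IntegrableOn φ (awayFrom S' ε ∩ Set.Icc a b) :=
      integrableOn_awayFrom_Icc hε a b fun τ h1 h2 => hφ τ h1 fun h => h2 (h ▸ hs')
    rw [← integral_inter_add_sdiff hBm hi]
    congr 2
    · congr 1
      ext τ
      simp only [hB, Set.mem_inter_iff]
      tauto
    · congr 1
      ext τ
      simp only [Set.mem_sdiff, Set.mem_inter_iff]
      refine ⟨fun h => ⟨⟨awayFrom_mono (Set.singleton_subset_iff.2 hs') ε h.1.1, h.1.2⟩, h.2⟩,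
        fun h => ⟨⟨?_, h.1.2⟩, h.2⟩⟩
      have hnear : |τ - s| ≤ δ / 2 := by
        by_contra! hc
        refine h.2 ⟨?_, h.1.2⟩
        rintro _ rfl
        exact hc
      intro s' hs''
      by_cases hne : s' = s
      · subst hne; exact h.1.1 _ rfl
      · have h3 := hsep s' (hsub hs'') hne
        have h4 : |s' - s| ≤ |s' - τ| + |τ - s| := abs_sub_le _ _ _
        rw [abs_sub_comm s' τ] at h4
        linarith
  rw [key S hS hs subset_rfl, key {s} (Set.finite_singleton s) rfl
    (Set.singleton_subset_iff.2 hs)]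
  ring

theorem setIntegral_awayFrom_singleton {s a b ε : ℝ} (hε : 0 < ε) (ha : a ≤ s - ε)
    (hb : s + ε ≤ b) {φ : ℝ → ℂ} (hφ : ∀ τ ∈ Set.Icc a b, τ ≠ s → ContinuousAt φ τ) :
    ∫ τ in awayFrom {s} ε ∩ Set.Icc a b, φ τ =
      (∫ τ in a..(s - ε), φ τ) + ∫ τ in (s + ε)..b, φ τ := by
  have h1 : awayFrom {s} ε ∩ Set.Icc a b = Set.Ico a (s - ε) ∪ Set.Ioc (s + ε) b := by
    ext τ
    simp only [awayFrom, Set.mem_singleton_iff, forall_eq, Set.mem_inter_iff, Set.mem_ofPred_eq,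
      Set.mem_Icc, Set.mem_union, Set.mem_Ico, Set.mem_Ioc, lt_abs]
    constructor
    · rintro ⟨h | h, h2, h3⟩
      · exact Or.inr ⟨by linarith, h3⟩
      · exact Or.inl ⟨h2, by linarith⟩
    · rintro (⟨h, h2⟩ | ⟨h, h2⟩)
      · exact ⟨Or.inr (by linarith), h, by linarith⟩
      · exact ⟨Or.inl (by linarith), by linarith, h2⟩
  have hi : IntegrableOn φ (awayFrom {s} ε ∩ Set.Icc a b) :=
    integrableOn_awayFrom_Icc hε a b fun τ h1 h2 => hφ τ h1 h2
  rw [h1] at hi ⊢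
  rw [setIntegral_union _ measurableSet_Ioc (hi.mono_set Set.subset_union_left)
      (hi.mono_set Set.subset_union_right), integral_Ico_eq_integral_Ioo,
    ← integral_Ioc_eq_integral_Ioo, intervalIntegral.integral_of_le ha,
    intervalIntegral.integral_of_le hb]
  rw [Set.disjoint_left]
  intro τ h2 h3
  linarith [h2.2, h3.1]

/-! ### Comparing the curve with a vertical segment by primitives -/

/-- The vertical line through the endpoint `curve T`. -/
noncomputable def vseg (T y : ℝ) : ℂ := (curve T).re + y * Complex.I

theorem vseg_re (T y : ℝ) : (vseg T y).re = (curve T).re := by simp [vseg]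

theorem vseg_im (T y : ℝ) : (vseg T y).im = y := by simp [vseg]

theorem vseg_angle (T : ℝ) : vseg T (angle T) = curve T := by rw [vseg, ← curve_eq_mk]

theorem vseg_neg_angle (T : ℝ) : vseg T (-angle T) = curve (-T) := by
  apply Complex.ext
  · rw [vseg_re, curve_re_neg]
  · rw [vseg_im, curve_im, angle_neg]

theorem hasDerivAt_vseg (T y : ℝ) : HasDerivAt (vseg T) Complex.I y := by
  have := ((hasDerivAt_id y).ofReal_comp.mul_const Complex.I).const_add ((curve T).re : ℂ)
  exact this.congr_deriv (by simp)

theorem continuous_vseg (T : ℝ) : Continuous (vseg T) := by unfold vseg; fun_prop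

theorem integral_curve_eq_sub {t H : ℂ → ℂ} {p q : ℝ}
    (hH : ∀ τ ∈ Set.uIcc p q, HasDerivAt H (t (curve τ)) (curve τ))
    (ht : ∀ τ ∈ Set.uIcc p q, ContinuousAt t (curve τ)) :
    ∫ τ in p..q, t (curve τ) * curveDeriv τ = H (curve q) - H (curve p) := by
  refine intervalIntegral.integral_eq_sub_of_hasDerivAt (f := H ∘ curve)
    (fun τ hτ => (hH τ hτ).comp τ (hasDerivAt_curve τ)) ?_
  refine ContinuousOn.intervalIntegrable fun τ hτ => ContinuousAt.continuousWithinAt ?_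
  exact (ContinuousAt.comp (f := curve) (ht τ hτ) continuous_curve.continuousAt).mul
    continuous_curveDeriv.continuousAt

theorem integral_vseg_eq_sub {t H : ℂ → ℂ} {T p q : ℝ}
    (hH : ∀ y ∈ Set.uIcc p q, HasDerivAt H (t (vseg T y)) (vseg T y))
    (ht : ∀ y ∈ Set.uIcc p q, ContinuousAt t (vseg T y)) :
    ∫ y in p..q, t (vseg T y) * Complex.I = H (vseg T q) - H (vseg T p) := by
  refine intervalIntegral.integral_eq_sub_of_hasDerivAt (f := H ∘ vseg T)
    (fun y hy => (hH y hy).comp y (hasDerivAt_vseg T y)) ?_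
  refine ContinuousOn.intervalIntegrable fun y hy => ContinuousAt.continuousWithinAt ?_
  exact (ContinuousAt.comp (f := vseg T) (ht y hy) (continuous_vseg T).continuousAt).mul
    continuousAt_const

/-- The principal value of `∫ t(w) dw` along the part `|τ| ≤ T` of the curve exceeds the integral
along the vertical segment with the same endpoints by `D`. -/
def HasContourDiff (S : Set ℝ) (T : ℝ) (t : ℂ → ℂ) (D : ℂ) : Prop :=
  Tendsto (fun ε : ℝ => ∫ τ in awayFrom S ε ∩ Set.Icc (-T) T, t (curve τ) * curveDeriv τ) (𝓝[>] 0)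
    (𝓝 (D + ∫ y in (-angle T)..(angle T), t (vseg T y) * Complex.I))

theorem angle_nonneg {T : ℝ} (hT : 0 ≤ T) : 0 ≤ angle T := by
  rw [← angle_zero]; exact angle_strictMono.monotone hT

theorem tendsto_setIntegral_curve {S : Set ℝ} (hS : S.Finite) {T : ℝ} (hT : 0 ≤ T) {t : ℂ → ℂ}
    (ht : ∀ τ ∈ Set.Icc (-T) T, ContinuousAt t (curve τ)) :
    Tendsto (fun ε : ℝ => ∫ τ in awayFrom S ε ∩ Set.Icc (-T) T, t (curve τ) * curveDeriv τ)
      (𝓝[>] 0) (𝓝 (∫ τ in (-T)..T, t (curve τ) * curveDeriv τ)) := by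
  have h1 : IntegrableOn (fun τ => t (curve τ) * curveDeriv τ) (Set.Icc (-T) T) := by
    refine ContinuousOn.integrableOn_Icc fun τ hτ => ContinuousAt.continuousWithinAt ?_
    exact (ContinuousAt.comp (f := curve) (ht τ hτ) continuous_curve.continuousAt).mul
      continuous_curveDeriv.continuousAt
  rw [intervalIntegral.integral_of_le (by linarith), ← integral_Icc_eq_integral_Ioc]
  exact tendsto_setIntegral_awayFrom hS h1

/-- The two paths share their endpoints, so a common primitive gives equal integrals. It is needed
only at the points of the two paths, which allows a branch of the logarithm whose cut misses both.
-/
theorem hasContourDiff_of_primitive {S : Set ℝ} (hS : S.Finite) {T : ℝ} (hT : 0 ≤ T)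
    {t H : ℂ → ℂ} (hH : ∀ τ ∈ Set.Icc (-T) T, HasDerivAt H (t (curve τ)) (curve τ))
    (ht : ∀ τ ∈ Set.Icc (-T) T, ContinuousAt t (curve τ))
    (hH' : ∀ y ∈ Set.Icc (-angle T) (angle T), HasDerivAt H (t (vseg T y)) (vseg T y))
    (ht' : ∀ y ∈ Set.Icc (-angle T) (angle T), ContinuousAt t (vseg T y)) :
    HasContourDiff S T t 0 := by
  have h1 := tendsto_setIntegral_curve hS hT ht
  have hT' := angle_nonneg hT
  rw [HasContourDiff, zero_add]
  rw [← Set.uIcc_of_le (by linarith)] at hH ht hH' ht'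
  rwa [integral_curve_eq_sub hH ht, ← vseg_angle, ← vseg_neg_angle,
    ← integral_vseg_eq_sub hH' ht'] at h1

theorem hasDerivAt_log_sub {w a : ℂ} (h : w - a ∈ Complex.slitPlane) :
    HasDerivAt (fun z => Complex.log (z - a)) ((w - a)⁻¹) w := by
  have := ((hasDerivAt_id w).sub_const a).clog h
  simpa using this

theorem hasDerivAt_log_sub_rev {w a : ℂ} (h : a - w ∈ Complex.slitPlane) :
    HasDerivAt (fun z => Complex.log (a - z)) ((w - a)⁻¹) w := by
  have := ((hasDerivAt_id w).const_sub a).clog h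
  refine this.congr_deriv ?_
  simp only [id]
  rw [← neg_sub w a, neg_div_neg_eq, one_div]

theorem continuousAt_inv_sub {w a : ℂ} (h : w ≠ a) : ContinuousAt (fun z => (z - a)⁻¹) w :=
  ContinuousAt.inv₀ (by fun_prop) (sub_ne_zero.2 h)

theorem ne_of_sub_mem_slitPlane {w a : ℂ} (h : w - a ∈ Complex.slitPlane) : w ≠ a := fun he =>
  Complex.slitPlane_ne_zero h (sub_eq_zero.2 he)

theorem log_neg_of_im_pos {u : ℂ} (h : 0 < u.im) :
    Complex.log (-u) = Complex.log u - Real.pi * Complex.I := by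
  rw [Complex.log, Complex.log, Complex.arg_neg_eq_arg_sub_pi_of_im_pos h, norm_neg]
  push_cast; ring

theorem log_neg_of_im_neg {u : ℂ} (h : u.im < 0) :
    Complex.log (-u) = Complex.log u + Real.pi * Complex.I := by
  rw [Complex.log, Complex.log, Complex.arg_neg_eq_arg_add_pi_of_im_neg h, norm_neg]
  push_cast; ring

/-- The jump of the logarithm across a point of the curve. -/
theorem tendsto_log_curve_sub (s : ℝ) :
    Tendsto (fun ε : ℝ => Complex.log (curve (s - ε) - curve s)
      - Complex.log (curve (s + ε) - curve s)) (𝓝[>] 0) (𝓝 (-(Real.pi * Complex.I))) := by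
  have hd := im_curveDeriv_pos s
  have hs := (hasDerivAt_curve s).tendsto_slope_zero
  have h1 : Tendsto (fun ε : ℝ => ε⁻¹ • (curve (s + ε) - curve s)) (𝓝[>] 0) (𝓝 (curveDeriv s)) :=
    hs.mono_left (nhdsWithin_mono _ fun _ h => ne_of_gt h)
  have hneg : Tendsto (fun ε : ℝ => -ε) (𝓝[>] 0) (𝓝[≠] 0) := by
    refine tendsto_nhdsWithin_iff.2 ⟨?_, ?_⟩
    · exact (continuous_neg.tendsto' (0 : ℝ) 0 neg_zero).mono_left nhdsWithin_le_nhds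
    · filter_upwards [self_mem_nhdsWithin] with ε hε
      exact neg_ne_zero.2 (ne_of_gt hε)
  have h2 : Tendsto (fun ε : ℝ => ε⁻¹ • (curve (s - ε) - curve s)) (𝓝[>] 0)
      (𝓝 (-curveDeriv s)) := by
    refine (hs.comp hneg).neg.congr fun ε => ?_
    simp only [Function.comp, inv_neg, neg_smul, neg_neg, sub_eq_add_neg]
  have m1 : curveDeriv s ∈ Complex.slitPlane := Or.inr hd.ne'
  have m2 : -curveDeriv s ∈ Complex.slitPlane := Or.inr (by simpa using hd.ne')
  have h3 := (h2.clog m2).sub (h1.clog m1)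
  rw [log_neg_of_im_pos hd, sub_sub_cancel_left] at h3
  refine h3.congr' ?_
  filter_upwards [self_mem_nhdsWithin] with ε hε
  have hε' : 0 < ε := hε
  have n1 : curve (s - ε) - curve s ≠ 0 := sub_ne_zero.2 fun h => by
    have := curve_injective h; linarith
  have n2 : curve (s + ε) - curve s ≠ 0 := sub_ne_zero.2 fun h => by
    have := curve_injective h; linarith
  rw [Complex.real_smul, Complex.real_smul, Complex.log_ofReal_mul (inv_pos.2 hε') n1,
    Complex.log_ofReal_mul (inv_pos.2 hε') n2]
  ring

open Classical in
/-- The weight of a pole: `1` inside the curve, `1/2` on it and `0` outside. -/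
noncomputable def weight (a : ℂ) : ℝ :=
  if h : ∃ τ, angle τ = a.im then step ((curve h.choose).re - a.re) else 0

theorem weight_eq {a : ℂ} {τ : ℝ} (h : angle τ = a.im) : weight a = step ((curve τ).re - a.re) := by
  have h' : ∃ τ, angle τ = a.im := ⟨τ, h⟩
  rw [weight, dif_pos h', angle_strictMono.injective (h'.choose_spec.trans h.symm)]

theorem weight_eq_zero {a : ℂ} (h : Real.pi ≤ |a.im|) : weight a = 0 := by
  rw [weight, dif_neg]
  rintro ⟨τ, hτ⟩
  have := abs_lt.2 (angle_mem τ)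
  rw [hτ] at this
  linarith

theorem step_of_pos {t : ℝ} (h : 0 < t) : step t = 1 := if_pos h

theorem step_zero : step 0 = 1 / 2 := by simp [step]

theorem step_of_neg {t : ℝ} (h : t < 0) : step t = 0 := by
  rw [step, if_neg (not_lt.2 h.le), if_neg h.ne]

/-- The branch `log (a - w)` is cut along the horizontal ray from `a` to the right, which neither
path meets. -/
theorem hasContourDiff_inv_sub_of_right {S : Set ℝ} (hS : S.Finite) {T : ℝ} (hT : 0 ≤ T) {a : ℂ}
    (h1 : (curve T).re < a.re) (h2 : ∀ τ, angle τ = a.im → (curve τ).re < a.re) :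
    HasContourDiff S T (fun w => (w - a)⁻¹) 0 := by
  have m1 : ∀ τ, a - curve τ ∈ Complex.slitPlane := fun τ => by
    by_cases h : angle τ = a.im
    · exact Or.inl (by simpa using h2 τ h)
    · right
      rw [Complex.sub_im, curve_im, sub_ne_zero]
      exact Ne.symm h
  have m2 : ∀ y, a - vseg T y ∈ Complex.slitPlane := fun y =>
    Or.inl (by simpa [vseg_re] using h1)
  exact hasContourDiff_of_primitive hS hT (fun τ _ => hasDerivAt_log_sub_rev (m1 τ))
    (fun τ _ => continuousAt_inv_sub (ne_of_sub_mem_slitPlane (m1 τ)).symm)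
    (fun y _ => hasDerivAt_log_sub_rev (m2 y))
    (fun y _ => continuousAt_inv_sub (ne_of_sub_mem_slitPlane (m2 y)).symm)

/-- Here `log (w - a)`, cut to the left of `a`, serves both paths, since nothing of the truncated
curve lies to the left of the segment. -/
theorem hasContourDiff_inv_sub_of_left {S : Set ℝ} (hS : S.Finite) {T : ℝ} (hT : 0 ≤ T) {a : ℂ}
    (h1 : a.re ≤ (curve T).re) (h2 : ∀ y ∈ Set.Icc (-angle T) (angle T), vseg T y ≠ a) :
    HasContourDiff S T (fun w => (w - a)⁻¹) 0 := by
  have m2 : ∀ y ∈ Set.Icc (-angle T) (angle T), vseg T y - a ∈ Complex.slitPlane := fun y hy => by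
    rw [Complex.mem_slitPlane_iff]
    by_contra! hc
    rw [Complex.sub_re, Complex.sub_im, vseg_re] at hc
    exact h2 y hy (Complex.ext (by rw [vseg_re]; linarith) (by linarith [hc.2]))
  have m1 : ∀ τ ∈ Set.Icc (-T) T, curve τ - a ∈ Complex.slitPlane := fun τ hτ => by
    have h3 := curve_re_le_of_abs_le (abs_le.2 hτ)
    rw [Complex.mem_slitPlane_iff]
    by_contra! hc
    rw [Complex.sub_re, Complex.sub_im] at hc
    refine h2 (angle τ) ⟨?_, angle_strictMono.monotone hτ.2⟩ (Complex.ext ?_ ?_)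
    · rw [← angle_neg]; exact angle_strictMono.monotone hτ.1
    · rw [vseg_re]; linarith
    · rw [vseg_im, ← curve_im]; linarith [hc.2]
  exact hasContourDiff_of_primitive hS hT (fun τ hτ => hasDerivAt_log_sub (m1 τ hτ))
    (fun τ hτ => continuousAt_inv_sub (ne_of_sub_mem_slitPlane (m1 τ hτ)))
    (fun y hy => hasDerivAt_log_sub (m2 y hy))
    (fun y hy => continuousAt_inv_sub (ne_of_sub_mem_slitPlane (m2 y hy)))

/-- The integral of `1 / (w - a)` along the vertical segment, `a` being to its right and between
the horizontal lines through its endpoints. -/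
theorem integral_vseg_inv_sub {T : ℝ} {a : ℂ} (h1 : (curve T).re < a.re) (h2 : |a.im| < angle T) :
    ∫ y in (-angle T)..(angle T), (vseg T y - a)⁻¹ * Complex.I =
      Complex.log (curve T - a) - Complex.log (curve (-T) - a) - 2 * Real.pi * Complex.I := by
  have m2 : ∀ y, a - vseg T y ∈ Complex.slitPlane := fun y =>
    Or.inl (by simpa [vseg_re] using h1)
  rw [integral_vseg_eq_sub (t := fun w => (w - a)⁻¹) (fun y _ => hasDerivAt_log_sub_rev (m2 y))
    (fun y _ => continuousAt_inv_sub (ne_of_sub_mem_slitPlane (m2 y)).symm), vseg_angle,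
    vseg_neg_angle, ← neg_sub (curve T) a, ← neg_sub (curve (-T)) a, log_neg_of_im_pos,
    log_neg_of_im_neg]
  · ring
  · rw [Complex.sub_im, curve_im, angle_neg]; linarith [neg_abs_le a.im]
  · rw [Complex.sub_im, curve_im]; linarith [le_abs_self a.im]

/-- No single branch works: the curve passes `a` on the right and needs `log (w - a)`, the segment
passes on the left and needs `log (a - w)`. The branches differ by `πi` with opposite signs at the
two endpoints, in total by `2πi`. -/
theorem hasContourDiff_inv_sub_of_inside {S : Set ℝ} (hS : S.Finite) {T : ℝ} (hT : 0 ≤ T) {a : ℂ}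
    (h1 : (curve T).re < a.re) {σ : ℝ} (hσ : angle σ = a.im) (h2 : a.re < (curve σ).re) :
    HasContourDiff S T (fun w => (w - a)⁻¹) (2 * Real.pi * Complex.I) := by
  have hσT : |σ| < T := abs_lt_of_curve_re_lt hT (h1.trans h2)
  have m1 : ∀ τ, curve τ - a ∈ Complex.slitPlane := fun τ => by
    by_cases h : τ = σ
    · subst h; exact Or.inl (by simpa using h2)
    · right
      rw [Complex.sub_im, curve_im, sub_ne_zero, ← hσ]
      exact fun h' => h (angle_strictMono.injective h')
  have h3 : |a.im| < angle T := by
    rw [← hσ, abs_lt, ← angle_neg]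
    exact ⟨angle_strictMono (abs_lt.1 hσT).1, angle_strictMono (abs_lt.1 hσT).2⟩
  have h4 := tendsto_setIntegral_curve hS hT (t := fun w => (w - a)⁻¹)
    fun τ _ => continuousAt_inv_sub (ne_of_sub_mem_slitPlane (m1 τ))
  rw [integral_curve_eq_sub (t := fun w => (w - a)⁻¹) (fun τ _ => hasDerivAt_log_sub (m1 τ))
    fun τ _ => continuousAt_inv_sub (ne_of_sub_mem_slitPlane (m1 τ))] at h4
  rw [HasContourDiff, integral_vseg_inv_sub h1 h3, add_sub_cancel]
  exact h4

/-- The curve climbs strictly, so `log (w - curve s)` is a primitive on each side of `s`. The two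
ends of the excised arc contribute `-πi` in the limit, leaving half of the full residue. -/
theorem hasContourDiff_inv_sub_curve {S : Set ℝ} (hS : S.Finite) {T s : ℝ} (hs : s ∈ S)
    (hsT : |s| < T) :
    HasContourDiff S T (fun w => (w - curve s)⁻¹) (Real.pi * Complex.I) := by
  have h1 := curve_re_lt_of_abs_lt hsT
  have h3 : |(curve s).im| < angle T := by
    rw [curve_im, abs_lt, ← angle_neg]
    exact ⟨angle_strictMono (abs_lt.1 hsT).1, angle_strictMono (abs_lt.1 hsT).2⟩
  have m1 : ∀ τ, τ ≠ s → curve τ - curve s ∈ Complex.slitPlane := fun τ h => by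
    right
    rw [Complex.sub_im, curve_im, sub_ne_zero, curve_im]
    exact fun h' => h (angle_strictMono.injective h')
  have hc : ∀ τ ∈ Set.Icc (-T) T, τ ≠ s →
      ContinuousAt (fun τ => (curve τ - curve s)⁻¹ * curveDeriv τ) τ := fun τ _ h =>
    (ContinuousAt.comp (f := curve) (g := fun w => (w - curve s)⁻¹)
      (continuousAt_inv_sub (ne_of_sub_mem_slitPlane (m1 τ h)))
      continuous_curve.continuousAt).mul continuous_curveDeriv.continuousAt
  rw [HasContourDiff, integral_vseg_inv_sub h1 h3]
  refine tendsto_setIntegral_awayFrom_of_singleton hS hs hc ?_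
  have h4 := (tendsto_log_curve_sub s).add_const
    (Complex.log (curve T - curve s) - Complex.log (curve (-T) - curve s))
  have h5 : Real.pi * Complex.I + (Complex.log (curve T - curve s)
      - Complex.log (curve (-T) - curve s) - 2 * Real.pi * Complex.I) =
      -(Real.pi * Complex.I) + (Complex.log (curve T - curve s)
      - Complex.log (curve (-T) - curve s)) := by ring
  rw [h5]
  refine h4.congr' ?_
  have hs1 : 0 < T - |s| := by linarith
  filter_upwards [self_mem_nhdsWithin, (eventually_lt_nhds hs1).filter_mono nhdsWithin_le_nhds]
    with ε hε0 hε1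
  have hε : 0 < ε := hε0
  have ha : -T ≤ s - ε := by linarith [neg_abs_le s]
  have hb : s + ε ≤ T := by linarith [le_abs_self s]
  have k1 : ∀ τ ∈ Set.uIcc (-T) (s - ε), τ ≠ s := fun τ hτ h => by
    rw [Set.uIcc_of_le ha] at hτ; linarith [hτ.2]
  have k2 : ∀ τ ∈ Set.uIcc (s + ε) T, τ ≠ s := fun τ hτ h => by
    rw [Set.uIcc_of_le hb] at hτ; linarith [hτ.1]
  rw [setIntegral_awayFrom_singleton hε ha hb hc,
    integral_curve_eq_sub (t := fun w => (w - curve s)⁻¹)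
      (fun τ h => hasDerivAt_log_sub (m1 τ (k1 τ h)))
      (fun τ h => continuousAt_inv_sub (ne_of_sub_mem_slitPlane (m1 τ (k1 τ h)))),
    integral_curve_eq_sub (t := fun w => (w - curve s)⁻¹)
      (fun τ h => hasDerivAt_log_sub (m1 τ (k2 τ h)))
      (fun τ h => continuousAt_inv_sub (ne_of_sub_mem_slitPlane (m1 τ (k2 τ h))))]
  ring

theorem hasContourDiff_inv_sub {S : Set ℝ} (hS : S.Finite) {T : ℝ} (hT : 0 ≤ T) {a : ℂ}
    (ha : ∀ y ∈ Set.Icc (-angle T) (angle T), vseg T y ≠ a) (haS : ∀ s, curve s = a → s ∈ S) :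
    HasContourDiff S T (fun w => (w - a)⁻¹)
      (2 * Real.pi * Complex.I * if (curve T).re < a.re then (weight a : ℂ) else 0) := by
  split_ifs with h
  · by_cases hex : ∃ σ, angle σ = a.im
    · obtain ⟨σ, hσ⟩ := hex
      rw [weight_eq hσ]
      rcases lt_trichotomy a.re (curve σ).re with h1 | h1 | h1
      · rw [step_of_pos (by linarith), Complex.ofReal_one, mul_one]
        exact hasContourDiff_inv_sub_of_inside hS hT h hσ h1
      · have h2 : curve σ = a := Complex.ext h1.symm (by rw [curve_im, hσ])
        have h3 := hasContourDiff_inv_sub_curve hS (haS σ h2)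
          (abs_lt_of_curve_re_lt hT (by rw [h2]; exact h))
        rw [h1, sub_self, step_zero]
        rw [h2] at h3
        convert h3 using 1
        push_cast; ring
      · rw [step_of_neg (by linarith), Complex.ofReal_zero, mul_zero]
        refine hasContourDiff_inv_sub_of_right hS hT h fun τ hτ => ?_
        rwa [angle_strictMono.injective (hτ.trans hσ.symm)]
    · rw [weight, dif_neg hex, Complex.ofReal_zero, mul_zero]
      exact hasContourDiff_inv_sub_of_right hS hT h fun τ hτ => absurd ⟨τ, hτ⟩ hex
  · rw [mul_zero]
    exact hasContourDiff_inv_sub_of_left hS hT (not_lt.1 h) ha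

/-! ### Linearity of the contour comparison -/

/-- Continuity on the vertical segment and on the curve away from `S`. -/
def RegularOn (S : Set ℝ) (T : ℝ) (t : ℂ → ℂ) : Prop :=
  (∀ τ ∈ Set.Icc (-T) T, τ ∉ S → ContinuousAt t (curve τ)) ∧
    ∀ y ∈ Set.Icc (-angle T) (angle T), ContinuousAt t (vseg T y)

theorem RegularOn.integrableOn_curve {S : Set ℝ} {T : ℝ} {t : ℂ → ℂ} (h : RegularOn S T t)
    {ε : ℝ} (hε : 0 < ε) :
    IntegrableOn (fun τ => t (curve τ) * curveDeriv τ) (awayFrom S ε ∩ Set.Icc (-T) T) :=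
  integrableOn_awayFrom_Icc hε _ _ fun τ h' hτ =>
    (ContinuousAt.comp (f := curve) (h.1 τ h' hτ) continuous_curve.continuousAt).mul
      continuous_curveDeriv.continuousAt

theorem RegularOn.intervalIntegrable {S : Set ℝ} {T : ℝ} (hT : 0 ≤ T) {t : ℂ → ℂ}
    (h : RegularOn S T t) :
    IntervalIntegrable (fun y => t (vseg T y) * Complex.I) volume (-angle T) (angle T) := by
  have := angle_nonneg hT
  refine ContinuousOn.intervalIntegrable fun y hy => ContinuousAt.continuousWithinAt ?_
  rw [Set.uIcc_of_le (by linarith)] at hy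
  exact (ContinuousAt.comp (f := vseg T) (h.2 y hy) (continuous_vseg T).continuousAt).mul
    continuousAt_const

theorem HasContourDiff.add {S : Set ℝ} {T : ℝ} (hT : 0 ≤ T) {t₁ t₂ : ℂ → ℂ} {D₁ D₂ : ℂ}
    (h₁ : HasContourDiff S T t₁ D₁) (h₂ : HasContourDiff S T t₂ D₂)
    (r₁ : RegularOn S T t₁) (r₂ : RegularOn S T t₂) :
    HasContourDiff S T (fun w => t₁ w + t₂ w) (D₁ + D₂) := by
  have h := Filter.Tendsto.add h₁ h₂
  rw [HasContourDiff]
  simp_rw [add_mul]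
  rw [intervalIntegral.integral_add (r₁.intervalIntegrable hT) (r₂.intervalIntegrable hT)]
  rw [show ∀ a b c d : ℂ, a + b + (c + d) = a + c + (b + d) by intros; ring]
  refine h.congr' ?_
  filter_upwards [self_mem_nhdsWithin] with ε hε
  rw [← integral_add (r₁.integrableOn_curve hε) (r₂.integrableOn_curve hε)]

theorem HasContourDiff.const_mul {S : Set ℝ} {T : ℝ} {t : ℂ → ℂ} {D : ℂ} (c : ℂ)
    (h : HasContourDiff S T t D) : HasContourDiff S T (fun w => c * t w) (c * D) := by
  have h' := Filter.Tendsto.const_mul c h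
  rw [HasContourDiff]
  simp_rw [mul_assoc, intervalIntegral.integral_const_mul, integral_const_mul]
  rwa [mul_add] at h'

theorem RegularOn.const_mul {S : Set ℝ} {T : ℝ} {t : ℂ → ℂ} (c : ℂ) (h : RegularOn S T t) :
    RegularOn S T (fun w => c * t w) :=
  ⟨fun τ h' hτ => continuousAt_const.mul (h.1 τ h' hτ), fun y hy => continuousAt_const.mul (h.2 y hy)⟩

theorem RegularOn.add {S : Set ℝ} {T : ℝ} {t₁ t₂ : ℂ → ℂ} (h₁ : RegularOn S T t₁)
    (h₂ : RegularOn S T t₂) : RegularOn S T (fun w => t₁ w + t₂ w) :=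
  ⟨fun τ h' hτ => (h₁.1 τ h' hτ).add (h₂.1 τ h' hτ), fun y hy => (h₁.2 y hy).add (h₂.2 y hy)⟩

theorem regularOn_sum {ι : Type*} {S : Set ℝ} {T : ℝ} (K : Finset ι) {t : ι → ℂ → ℂ}
    (h : ∀ i ∈ K, RegularOn S T (t i)) : RegularOn S T (fun w => ∑ i ∈ K, t i w) :=
  ⟨fun τ h' hτ => tendsto_finsetSum _ fun i hi => (h i hi).1 τ h' hτ,
    fun y hy => tendsto_finsetSum _ fun i hi => (h i hi).2 y hy⟩

theorem hasContourDiff_sum {ι : Type*} {S : Set ℝ} {T : ℝ} (hT : 0 ≤ T) (K : Finset ι)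
    {t : ι → ℂ → ℂ} {D : ι → ℂ} (h : ∀ i ∈ K, HasContourDiff S T (t i) (D i))
    (r : ∀ i ∈ K, RegularOn S T (t i)) :
    HasContourDiff S T (fun w => ∑ i ∈ K, t i w) (∑ i ∈ K, D i) := by
  classical
  induction K using Finset.induction_on with
  | empty => simp [HasContourDiff]
  | insert i K hi ih =>
    simp_rw [Finset.sum_insert hi]
    exact (h i (Finset.mem_insert_self i K)).add hT
      (ih (fun j hj => h j (Finset.mem_insert_of_mem hj))
        fun j hj => r j (Finset.mem_insert_of_mem hj))
      (r i (Finset.mem_insert_self i K))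
      (regularOn_sum K fun j hj => r j (Finset.mem_insert_of_mem hj))

theorem HasContourDiff.congr {S : Set ℝ} (hS : S.Finite) {T : ℝ} (hT : 0 ≤ T) {t₁ t₂ : ℂ → ℂ}
    {D : ℂ} (h : HasContourDiff S T t₁ D)
    (hc : ∀ τ ∈ Set.Icc (-T) T, τ ∉ S → t₁ (curve τ) = t₂ (curve τ))
    (hv : ∀ y ∈ Set.Icc (-angle T) (angle T), t₁ (vseg T y) = t₂ (vseg T y)) :
    HasContourDiff S T t₂ D := by
  have hT' := angle_nonneg hT
  have h1 : ∫ y in (-angle T)..(angle T), t₁ (vseg T y) * Complex.I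
      = ∫ y in (-angle T)..(angle T), t₂ (vseg T y) * Complex.I := by
    refine intervalIntegral.integral_congr fun y hy => ?_
    rw [Set.uIcc_of_le (by linarith)] at hy
    simp only [hv y hy]
  rw [HasContourDiff, ← h1]
  refine Filter.Tendsto.congr' ?_ h
  filter_upwards [self_mem_nhdsWithin] with ε hε
  refine setIntegral_congr_fun ((measurableSet_awayFrom hS ε).inter measurableSet_Icc)
    fun τ hτ => ?_
  rw [hc τ hτ.2 fun h => ?_]
  have h2 := hτ.1 τ h
  rw [sub_self, abs_zero] at h2
  exact absurd hε (not_lt.2 h2.le)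

/-! ### Principal parts of the kernel -/

/-- Riemann's theorem on removable singularities at finitely many points. -/
theorem exists_differentiableOn_extension {U P : Set ℂ} (hU : IsOpen U) (hP : P.Finite)
    {f : ℂ → ℂ} (hf : ∀ w ∈ U, w ∉ P → DifferentiableAt ℂ f w)
    (hp : ∀ p ∈ P, p ∈ U → Tendsto (fun z => (z - p) * f z) (𝓝[≠] p) (𝓝 0)) :
    ∃ h : ℂ → ℂ, DifferentiableOn ℂ h U ∧ ∀ w, w ∉ P → h w = f w := by
  classical
  refine ⟨fun w => if w ∈ P then limUnder (𝓝[≠] w) f else f w, fun w hw => ?_,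
    fun w hw => if_neg hw⟩
  refine DifferentiableAt.differentiableWithinAt ?_
  have hs : (U \ (P \ {w})) ∈ 𝓝 w :=
    (hU.sdiff (hP.subset Set.sdiff_subset).isClosed).mem_nhds ⟨hw, fun h => h.2 rfl⟩
  by_cases hwP : w ∈ P
  · have hd : DifferentiableOn ℂ f ((U \ (P \ {w})) \ {w}) := fun z hz =>
      (hf z hz.1.1 fun hzP => hz.1.2 ⟨hzP, hz.2⟩).differentiableWithinAt
    have ho : (fun z => f z - f w) =o[𝓝[≠] w] fun z => (z - w)⁻¹ := by
      rw [Asymptotics.isLittleO_iff_tendsto']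
      · have h1 : Tendsto (fun z => (z - w) * f w) (𝓝[≠] w) (𝓝 0) := by
          have : Continuous fun z => (z - w) * f w := by fun_prop
          exact (this.tendsto' w 0 (by simp)).mono_left nhdsWithin_le_nhds
        have h2 := (hp w hwP hw).sub h1
        rw [sub_zero] at h2
        refine h2.congr fun z => ?_
        rw [div_inv_eq_mul]; ring
      · filter_upwards [self_mem_nhdsWithin] with z hz h
        exact absurd (inv_eq_zero.1 h) (sub_ne_zero.2 hz)
    have h3 := (Complex.differentiableOn_update_limUnder_of_isLittleO hs hd ho).differentiableAt hs
    refine h3.congr_of_eventuallyEq ?_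
    filter_upwards [hs] with z hz
    by_cases hzw : z = w
    · subst hzw; simp [hwP]
    · have : z ∉ P := fun h => hz.2 ⟨h, hzw⟩
      simp [this, hzw]
  · refine (hf w hw hwP).congr_of_eventuallyEq ?_
    filter_upwards [hs] with z hz
    by_cases hzw : z = w
    · subst hzw; simp [hwP]
    · have : z ∉ P := fun h => hz.2 ⟨h, hzw⟩
      simp [this]

/-- The coefficients `B_j(t) / j!` of the generating function `z e^{tz} / (e^z - 1)`. -/
noncomputable def bernoulliCoeff (t : ℂ) (j : ℕ) : ℂ :=
  Polynomial.aeval t (Polynomial.bernoulli j) / (j.factorial : ℂ)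

theorem bernoulliCoeff_generating (t : ℂ) :
    PowerSeries.mk (bernoulliCoeff t) * (PowerSeries.exp ℂ - 1) =
      PowerSeries.X * PowerSeries.rescale t (PowerSeries.exp ℂ) := by
  rw [← Polynomial.bernoulli_generating_function]
  congr 2
  ext j
  rw [bernoulliCoeff, map_smul, Rat.smul_def]
  push_cast
  ring

-- The formal generating identity, truncated at degree `N`, leaves a polynomial divisible by `X ^
-- N`; replacing the truncated exponentials by the true ones costs another `O(u^N)`. This avoids
-- proving convergence of the Bernoulli series.
open Asymptotics in
theorem bernoulliCoeff_isBigO (t : ℂ) (N : ℕ) :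
    (fun u : ℂ => u * Complex.exp (t * u)
      - (∑ j ∈ Finset.range N, bernoulliCoeff t j * u ^ j) * (Complex.exp u - 1))
      =O[𝓝 0] fun u => u ^ N := by
  set B := PowerSeries.mk (bernoulliCoeff t) with hB
  set Q := PowerSeries.exp ℂ - 1 with hQ
  set E := PowerSeries.rescale t (PowerSeries.exp ℂ) with hE
  set p : Polynomial ℂ := Polynomial.X * PowerSeries.trunc N E
    - PowerSeries.trunc N B * PowerSeries.trunc N Q with hp
  have hdvd : Polynomial.X ^ N ∣ p := by
    rw [Polynomial.X_pow_dvd_iff]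
    intro d hd
    have h1 : PowerSeries.coeff d (B * Q) = PowerSeries.coeff d (PowerSeries.X * E) := by
      rw [bernoulliCoeff_generating]
    rw [PowerSeries.coeff_mul_eq_coeff_trunc_mul_trunc _ _ hd, ← Polynomial.coe_mul,
      Polynomial.coeff_coe] at h1
    rw [hp, Polynomial.coeff_sub, h1]
    rcases d with _ | d
    · simp
    · rw [Polynomial.coeff_X_mul, PowerSeries.coeff_succ_X_mul, PowerSeries.coeff_trunc,
        if_pos (by omega), sub_self]
  obtain ⟨q, hq⟩ := hdvd
  have e1 : ∀ u, (PowerSeries.trunc N B).eval u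
      = ∑ j ∈ Finset.range N, bernoulliCoeff t j * u ^ j := fun u => by
    rw [Polynomial.eval, PowerSeries.eval₂_trunc_eq_sum_range]
    simp [hB]
  have e2 : ∀ u, (PowerSeries.trunc N E).eval u
      = ∑ j ∈ Finset.range N, (t * u) ^ j / (j.factorial : ℂ) := fun u => by
    rw [Polynomial.eval, PowerSeries.eval₂_trunc_eq_sum_range]
    refine Finset.sum_congr rfl fun j _ => ?_
    simp [hE, PowerSeries.coeff_exp, mul_pow]
    ring
  have e3 : (fun u : ℂ => (Complex.exp u - 1) - (PowerSeries.trunc N Q).eval u)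
      =O[𝓝 0] fun u => u ^ N := by
    rcases N with _ | N
    · have h1 : ContinuousAt (fun u : ℂ => (Complex.exp u - 1)
          - (PowerSeries.trunc 0 Q).eval u) 0 := by fun_prop
      simpa using h1.isBigO_one ℂ
    · refine (Complex.exp_sub_sum_range_isBigO_pow (N + 1)).congr_left fun u => ?_
      rw [Polynomial.eval, PowerSeries.eval₂_trunc_eq_sum_range, Finset.sum_range_succ',
        Finset.sum_range_succ']
      simp [hQ, PowerSeries.coeff_exp, PowerSeries.coeff_one]
      rw [show ∀ a b c : ℂ, a - (b + 1) = a - 1 - c ↔ c = b from fun a b c =>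
        ⟨fun h => by linear_combination h, fun h => by linear_combination h⟩]
      exact Finset.sum_congr rfl fun j _ => by ring
  have e4 : (fun u : ℂ => Complex.exp (t * u) - (PowerSeries.trunc N E).eval u)
      =O[𝓝 0] fun u => u ^ N := by
    simp_rw [e2]
    have h1 := (Complex.exp_sub_sum_range_isBigO_pow N).comp_tendsto
      (k := fun u : ℂ => t * u) (l := 𝓝 0)
      ((continuous_const.mul continuous_id).tendsto' 0 0 (by simp))
    refine h1.trans ?_
    simp only [Function.comp_def, mul_pow]
    exact isBigO_const_mul_self _ _ _
  have b1 : (fun u : ℂ => u) =O[𝓝 0] (1 : ℂ → ℂ) := continuousAt_id.isBigO_one ℂ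
  have b2 : (fun u : ℂ => (PowerSeries.trunc N B).eval u) =O[𝓝 0] (1 : ℂ → ℂ) :=
    (PowerSeries.trunc N B).continuous.continuousAt.isBigO_one ℂ
  have b3 : (fun u : ℂ => p.eval u) =O[𝓝 0] fun u => u ^ N := by
    rw [hq]
    simp only [Polynomial.eval_mul, Polynomial.eval_pow, Polynomial.eval_X]
    have := (isBigO_refl (fun u : ℂ => u ^ N) (𝓝 0)).mul (q.continuous.continuousAt.isBigO_one ℂ)
    simpa using this
  have h1 := b1.mul e4
  have h2 := b2.mul e3
  simp only [Pi.one_apply, one_mul] at h1 h2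
  refine ((h1.sub h2).add b3).congr_left fun u => ?_
  rw [← e1, hp]
  simp only [Polynomial.eval_sub, Polynomial.eval_mul, Polynomial.eval_X]
  ring

open Asymptotics in
/-- The Taylor expansion of `u e^{tu} / (e^u - 1)` at the origin. -/
theorem tendsto_bernoulli_remainder (t : ℂ) (n : ℕ) :
    Tendsto (fun u : ℂ => (u * Complex.exp (t * u) / (Complex.exp u - 1)
      - ∑ j ∈ Finset.range (n + 1), bernoulliCoeff t j * u ^ j) / u ^ n) (𝓝[≠] 0) (𝓝 0) := by
  have h1 := tendsto_exp_sub_one_div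
  have h0 : Tendsto (fun u : ℂ => u) (𝓝[≠] 0) (𝓝 0) := nhdsWithin_le_nhds
  -- Two orders more than `u^n`: one is used up by dividing by `e^u - 1`, the other makes the limit
  -- vanish. The surplus term of degree `n + 1` is restored in `h3`.
  have h2 : Tendsto (fun u : ℂ => (u * Complex.exp (t * u)
      - (∑ j ∈ Finset.range (n + 2), bernoulliCoeff t j * u ^ j) * (Complex.exp u - 1))
      / u ^ (n + 1)) (𝓝[≠] 0) (𝓝 0) :=
    (((bernoulliCoeff_isBigO t (n + 2)).trans_isLittleO
      (isLittleO_pow_pow (by omega))).mono nhdsWithin_le_nhds).tendsto_div_nhds_zero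
  have h3 := (h2.div h1 one_ne_zero).add (h0.const_mul (bernoulliCoeff t (n + 1)))
  simp only [zero_div, mul_zero, add_zero] at h3
  refine h3.congr' ?_
  filter_upwards [self_mem_nhdsWithin, h1.eventually_ne one_ne_zero] with u hu hne
  have hu0 : u ≠ 0 := hu
  have he : Complex.exp u - 1 ≠ 0 := fun h => hne (by rw [h, zero_div])
  simp only [Pi.div_apply]
  rw [Finset.sum_range_succ _ (n + 1)]
  field_simp
  ring

theorem exp_pole_div {x : ℂ} (hx : x ≠ 0) (k : ℤ) : Complex.exp (pole x k / x) = 1 :=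
  (exp_div_eq_one_iff hx).2 ⟨k, rfl⟩

/-- The residue of `kernel n x` at the simple pole `p`. -/
theorem tendsto_sub_mul_kernel {n : ℕ} {x : ℂ} (hx : x ≠ 0) {k : ℤ} (hk : k ≠ 0) :
    Tendsto (fun z => (z - pole x k) * kernel n x z) (𝓝[≠] (pole x k))
      (𝓝 (Complex.exp (n * pole x k) / pole x k ^ n)) := by
  set p := pole x k with hp
  have hp0 : p ≠ 0 := pole_ne_zero hx hk
  have hd : HasDerivAt (fun z => x * (Complex.exp (z / x) - 1)) 1 p := by
    have h1 := ((((hasDerivAt_id p).div_const x).cexp).sub_const 1).const_mul x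
    refine h1.congr_deriv ?_
    simp only [id]
    rw [hp, exp_pole_div hx]
    field_simp
  have h2 := hd.tendsto_slope.inv₀ one_ne_zero
  have hc : ContinuousAt (fun z => Complex.exp (n * z) / z ^ n) p :=
    ContinuousAt.div (by fun_prop) (by fun_prop) (pow_ne_zero _ hp0)
  have h3 := (hc.tendsto.mono_left (nhdsWithin_le_nhds (s := {p}ᶜ))).mul h2
  rw [inv_one, mul_one] at h3
  refine h3.congr' ?_
  filter_upwards [self_mem_nhdsWithin] with z hz
  rw [slope_def_field, hp, exp_pole_div hx, ← hp, kernel, sub_self, mul_zero, sub_zero, inv_div]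
  rw [div_mul_div_comm, mul_comm (z - p), div_mul_eq_mul_div]

theorem differentiableAt_kernel {n : ℕ} {x w : ℂ} (hx : x ≠ 0) (hw : w ≠ 0)
    (h : Complex.exp (w / x) ≠ 1) : DifferentiableAt ℂ (kernel n x) w := by
  unfold kernel
  refine DifferentiableAt.div (by fun_prop) (by fun_prop) ?_
  exact mul_ne_zero (pow_ne_zero _ hw) (mul_ne_zero hx (sub_ne_zero.2 h))

/-- The principal part of `kernel n x` at the origin. -/
theorem tendsto_mul_kernel_sub {n : ℕ} {x : ℂ} (hx : x ≠ 0) :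
    Tendsto (fun z => z * (kernel n x z - ∑ j ∈ Finset.range (n + 1),
      bernoulliCoeff (n * x) j / x ^ j * z ^ ((j : ℤ) - n - 1))) (𝓝[≠] 0) (𝓝 0) := by
  have hk : Tendsto (fun z : ℂ => z / x) (𝓝[≠] 0) (𝓝[≠] 0) := by
    refine tendsto_nhdsWithin_iff.2 ⟨?_, ?_⟩
    · have : Continuous fun z : ℂ => z / x := by fun_prop
      exact (this.tendsto' 0 0 (by simp)).mono_left nhdsWithin_le_nhds
    · filter_upwards [self_mem_nhdsWithin] with z hz
      exact div_ne_zero hz hx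
  have h := ((tendsto_bernoulli_remainder (n * x) n).comp hk).div_const (x ^ n)
  rw [zero_div] at h
  refine h.congr' ?_
  filter_upwards [self_mem_nhdsWithin] with z hz
  have hz0 : z ≠ 0 := hz
  simp only [Function.comp]
  have h1 : ∀ j ∈ Finset.range (n + 1), bernoulliCoeff (n * x) j / x ^ j * z ^ ((j : ℤ) - n - 1)
      = bernoulliCoeff (n * x) j * (z / x) ^ j * (z ^ (n + 1))⁻¹ := fun j _ => by
    rw [div_pow, sub_sub, zpow_sub₀ hz0, zpow_natCast, show ((n : ℤ) + 1) = ((n + 1 : ℕ) : ℤ) by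
      push_cast; ring, zpow_natCast]
    ring
  rw [Finset.sum_congr rfl h1, ← Finset.sum_mul, kernel,
    show (n : ℂ) * x * (z / x) = n * z by field_simp, div_pow]
  set A := ∑ j ∈ Finset.range (n + 1), bernoulliCoeff (n * x) j * (z / x) ^ j
  by_cases he : Complex.exp (z / x) - 1 = 0
  · rw [he]
    simp only [mul_zero, div_zero, zero_sub]
    field_simp
    ring
  · field_simp
    ring

theorem weight_zero : weight 0 = 1 := by
  rw [weight_eq (τ := 0) (by simp [angle_zero]), curve_zero]
  exact step_of_pos (by simp)

theorem vseg_ne_zero {T : ℝ} (h : (curve T).re < 0) (y : ℝ) : vseg T y ≠ 0 := fun he => by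
  have := congrArg Complex.re he
  rw [vseg_re, Complex.zero_re] at this
  linarith

/-- Every power except `w⁻¹` has a single-valued primitive off the origin; for `w⁻¹` the origin is a
point inside the curve and to the right of the segment. -/
theorem hasContourDiff_zpow {S : Set ℝ} (hS : S.Finite) {T : ℝ} (hT : 0 ≤ T)
    (hre : (curve T).re < 0) (n j : ℕ) :
    HasContourDiff S T (fun w => w ^ ((j : ℤ) - n - 1))
      (if j = n then 2 * Real.pi * Complex.I else 0) := by
  split_ifs with h
  · subst h
    have h1 := hasContourDiff_inv_sub hS hT (a := 0) (fun y _ => vseg_ne_zero hre y)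
      fun s hs => absurd hs (curve_ne_zero s)
    rw [Complex.zero_re, if_pos hre, weight_zero, Complex.ofReal_one, mul_one] at h1
    simpa using h1
  · have hne : ((j : ℂ) - n) ≠ 0 := by
      rw [sub_ne_zero]; exact_mod_cast h
    have hd : ∀ w : ℂ, w ≠ 0 →
        HasDerivAt (fun w : ℂ => w ^ ((j : ℤ) - n) / ((j : ℂ) - n)) (w ^ ((j : ℤ) - n - 1)) w :=
      fun w hw => by
        refine ((hasDerivAt_zpow ((j : ℤ) - n) w (Or.inl hw)).div_const _).congr_deriv ?_
        push_cast
        field_simp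
    have hc : ∀ w : ℂ, w ≠ 0 → ContinuousAt (fun w : ℂ => w ^ ((j : ℤ) - n - 1)) w :=
      fun w hw => continuousAt_zpow₀ w _ (Or.inl hw)
    exact hasContourDiff_of_primitive hS hT (fun τ _ => hd _ (curve_ne_zero τ))
      (fun τ _ => hc _ (curve_ne_zero τ)) (fun y _ => hd _ (vseg_ne_zero hre y))
      (fun y _ => hc _ (vseg_ne_zero hre y))

/-! ### The residue theorem for the truncated region -/

/-- The residue theorem for `kernel n x` and the region between the curve and a vertical segment. -/
theorem hasContourDiff_kernel (n : ℕ) {x : ℂ} (hx : x ≠ 0) {T : ℝ} (hT : 0 ≤ T)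
    (hre : (curve T).re < 0)
    (hV : ∀ y ∈ Set.Icc (-angle T) (angle T), Complex.exp (vseg T y / x) ≠ 1) :
    ∃ ρ : ℝ, ∀ K : Finset ℤ, 0 ∉ K → (∀ k : ℤ, k ≠ 0 → ‖pole x k‖ < ρ → k ∈ K) →
      HasContourDiff (singularSet x) T (kernel n x) (2 * Real.pi * Complex.I *
        (bernoulliCoeff (n * x) n / x ^ n + ∑ k ∈ K, Complex.exp (n * pole x k) / pole x k ^ n *
          if (curve T).re < (pole x k).re then (weight (pole x k) : ℂ) else 0)) := by
  have hS := finite_singularSet hx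
  obtain ⟨C, hC⟩ := (isCompact_Icc (a := -T) (b := T)).exists_bound_of_continuousOn
    continuous_curve.continuousOn
  obtain ⟨C', hC'⟩ := (isCompact_Icc (a := -angle T) (b := angle T)).exists_bound_of_continuousOn
    (continuous_vseg T).continuousOn
  -- The disc of radius `ρ` about `0` contains both paths. Its poles must be in `K`; further poles
  -- in `K` do no harm.
  set ρ := max C C' + 1 with hρ
  have hcρ : ∀ τ ∈ Set.Icc (-T) T, curve τ ∈ Metric.ball 0 ρ := fun τ hτ => by
    rw [mem_ball_zero_iff]; linarith [hC τ hτ, le_max_left C C']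
  have hvρ : ∀ y ∈ Set.Icc (-angle T) (angle T), vseg T y ∈ Metric.ball 0 ρ := fun y hy => by
    rw [mem_ball_zero_iff]; linarith [hC' y hy, le_max_right C C']
  refine ⟨ρ, fun K hK0 hK => ?_⟩
  set r : ℤ → ℂ := fun k => Complex.exp (n * pole x k) / pole x k ^ n with hr
  set e : ℕ → ℂ := fun j => bernoulliCoeff (n * x) j / x ^ j with he
  set q₁ : ℂ → ℂ := fun w => ∑ k ∈ K, r k * (w - pole x k)⁻¹ with hq₁
  set q₂ : ℂ → ℂ := fun w => ∑ j ∈ Finset.range (n + 1), e j * w ^ ((j : ℤ) - n - 1) with hq₂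
  set P : Set ℂ := insert 0 (pole x '' K) with hP
  have hPf : P.Finite := (K.finite_toSet.image _).insert 0
  have hd₁ : ∀ w, w ∉ pole x '' K → DifferentiableAt ℂ q₁ w := fun w hw => by
    refine DifferentiableAt.fun_sum fun k hk => DifferentiableAt.const_mul ?_ _
    refine DifferentiableAt.inv (by fun_prop) (sub_ne_zero.2 fun h => hw ⟨k, hk, h.symm⟩)
  have hd₂ : ∀ w, w ≠ 0 → DifferentiableAt ℂ q₂ w := fun w hw => by
    refine DifferentiableAt.fun_sum fun j _ => DifferentiableAt.const_mul ?_ _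
    exact differentiableAt_zpow.2 (Or.inl hw)
  -- Kernel minus principal parts is holomorphic on the disc. At each singularity only its own
  -- principal part matters, the remaining ones being regular there.
  obtain ⟨h, hh, heq⟩ := exists_differentiableOn_extension (U := Metric.ball 0 ρ) Metric.isOpen_ball
    hPf (f := fun w => kernel n x w - (q₁ w + q₂ w)) (fun w hw hwP => by
      have hw0 : w ≠ 0 := fun h => hwP (Or.inl h)
      have hwK : w ∉ pole x '' K := fun h => hwP (Or.inr h)
      refine (differentiableAt_kernel hx hw0 fun hE => ?_).sub ((hd₁ w hwK).add (hd₂ w hw0))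
      obtain ⟨k, rfl⟩ := (exp_div_eq_one_iff hx).1 hE
      refine hwK ⟨k, hK k ?_ (by simpa using hw), rfl⟩
      rintro rfl
      simp [pole] at hw0) (by
      rintro p (rfl | ⟨k, hk, rfl⟩) _
      · have h0 : (0 : ℂ) ∉ pole x '' K := by
          rintro ⟨k, hk, h⟩
          exact pole_ne_zero hx (fun h => hK0 (h ▸ hk)) h
        have h1 : Tendsto (fun z => z * q₁ z) (𝓝[≠] 0) (𝓝 0) := by
          have : ContinuousAt (fun z => z * q₁ z) 0 :=
            continuousAt_id.mul (hd₁ 0 h0).continuousAt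
          have h2 := this.tendsto
          rw [zero_mul] at h2
          exact h2.mono_left nhdsWithin_le_nhds
        have h2 := (tendsto_mul_kernel_sub (n := n) hx).sub h1
        rw [sub_zero] at h2
        refine h2.congr fun z => ?_
        simp only [hq₂, he]
        ring
      · have hk' : k ∈ K := hk
        have hk0 : k ≠ 0 := fun h => hK0 (h ▸ hk')
        set p := pole x k with hp
        have h1 : Tendsto (fun z => (z - p) * (∑ i ∈ K.erase k, r i * (z - pole x i)⁻¹ + q₂ z))
            (𝓝[≠] p) (𝓝 0) := by
          have hc : ContinuousAt (fun z => ∑ i ∈ K.erase k, r i * (z - pole x i)⁻¹) p := by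
            refine tendsto_finsetSum _ fun i hi => ?_
            refine continuousAt_const.mul (continuousAt_inv_sub fun h => ?_)
            exact (Finset.ne_of_mem_erase hi) (pole_injective hx h.symm)
          have : ContinuousAt (fun z => (z - p) *
              (∑ i ∈ K.erase k, r i * (z - pole x i)⁻¹ + q₂ z)) p :=
            (continuousAt_id.sub continuousAt_const).mul
              (hc.add (hd₂ p (pole_ne_zero hx hk0)).continuousAt)
          have h2 := this.tendsto
          rw [sub_self, zero_mul] at h2
          exact h2.mono_left nhdsWithin_le_nhds
        have h2 := ((tendsto_sub_mul_kernel (n := n) hx hk0).sub_const (r k)).sub h1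
        rw [sub_self, sub_zero] at h2
        refine h2.congr' ?_
        filter_upwards [self_mem_nhdsWithin] with z hz
        have hz' : z - p ≠ 0 := sub_ne_zero.2 hz
        simp only [hq₁]
        rw [← Finset.add_sum_erase K _ hk', ← hp]
        field_simp
        ring)
  -- A primitive on the disc, so the holomorphic remainder contributes nothing.
  obtain ⟨H, hH⟩ := hh.isExactOn_ball
  have hcont : ∀ w ∈ Metric.ball (0 : ℂ) ρ, ContinuousAt h w := fun w hw =>
    (hh.differentiableAt (Metric.isOpen_ball.mem_nhds hw)).continuousAt
  have hpV : ∀ k, ∀ y ∈ Set.Icc (-angle T) (angle T), vseg T y ≠ pole x k := fun k y hy he =>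
    hV y hy (by rw [he, exp_pole_div hx])
  have hpS : ∀ k s, curve s = pole x k → s ∈ singularSet x := fun k s hs => by
    rw [mem_singularSet_iff hx, hs, exp_pole_div hx]
  have D0 : HasContourDiff (singularSet x) T h 0 :=
    hasContourDiff_of_primitive hS hT (fun τ hτ => hH _ (hcρ τ hτ)) (fun τ hτ => hcont _ (hcρ τ hτ))
      (fun y hy => hH _ (hvρ y hy)) (fun y hy => hcont _ (hvρ y hy))
  have R0 : RegularOn (singularSet x) T h :=
    ⟨fun τ hτ _ => hcont _ (hcρ τ hτ), fun y hy => hcont _ (hvρ y hy)⟩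
  have R1' : ∀ k ∈ K, RegularOn (singularSet x) T fun w => r k * (w - pole x k)⁻¹ := fun k _ =>
    RegularOn.const_mul _ ⟨fun τ _ hτ => continuousAt_inv_sub fun he => hτ (hpS k τ he),
      fun y hy => continuousAt_inv_sub (hpV k y hy)⟩
  have D1 := hasContourDiff_sum hT K (fun k _ =>
    (hasContourDiff_inv_sub hS hT (hpV k) (hpS k)).const_mul (r k)) R1'
  have R2' : ∀ j ∈ Finset.range (n + 1),
      RegularOn (singularSet x) T fun w => e j * w ^ ((j : ℤ) - n - 1) := fun j _ =>
    RegularOn.const_mul _ ⟨fun τ _ _ => continuousAt_zpow₀ _ _ (Or.inl (curve_ne_zero τ)),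
      fun y _ => continuousAt_zpow₀ _ _ (Or.inl (vseg_ne_zero hre y))⟩
  have D2 := hasContourDiff_sum hT (Finset.range (n + 1)) (fun j _ =>
    (hasContourDiff_zpow hS hT hre n j).const_mul (e j)) R2'
  have R1 := regularOn_sum K R1'
  have R2 := regularOn_sum _ R2'
  have D := D0.add hT (D1.add hT D2 R1 R2) R0 (R1.add R2)
  have hfin : ∀ w, w ≠ 0 → Complex.exp (w / x) ≠ 1 →
      h w + (∑ k ∈ K, r k * (w - pole x k)⁻¹
        + ∑ j ∈ Finset.range (n + 1), e j * w ^ ((j : ℤ) - n - 1)) = kernel n x w := by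
    intro w hw hE
    rw [heq w]
    · simp only [hq₁, hq₂]; ring
    · rintro (h0 | ⟨k, -, hk⟩)
      · exact hw h0
      · exact hE (by rw [← hk, exp_pole_div hx])
  have D' := D.congr hS hT (t₂ := kernel n x)
    (fun τ _ hτ => hfin _ (curve_ne_zero τ) fun hE => hτ ((mem_singularSet_iff hx τ).2 hE))
    (fun y hy => hfin _ (vseg_ne_zero hre y) (hV y hy))
  convert D' using 1
  rw [zero_add, add_comm, mul_add, Finset.mul_sum, add_comm]
  simp only [mul_ite, mul_zero]
  rw [Finset.sum_ite_eq' _ n, if_pos (Finset.self_mem_range_succ n), add_comm,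
    mul_comm (e n)]
  congr 1
  exact Finset.sum_congr rfl fun k _ => by split_ifs <;> ring

/-! ### Moving the segment to the left -/

theorem tendsto_tail {f : ℝ → ℂ} {T₀ : ℝ} (hf : IntegrableOn f (Set.Icc (-T₀) T₀)ᶜ) :
    Tendsto (fun T : ℝ => ∫ τ in (Set.Icc (-T) T)ᶜ, f τ) atTop (𝓝 0) := by
  have h1 : ∀ᶠ T in atTop, ∫ τ in (Set.Icc (-T₀) T₀)ᶜ, ((Set.Icc (-T) T)ᶜ).indicator f τ
      = ∫ τ in (Set.Icc (-T) T)ᶜ, f τ := by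
    filter_upwards [eventually_ge_atTop T₀] with T hT
    rw [setIntegral_indicator measurableSet_Icc.compl, Set.inter_eq_right.2]
    exact Set.compl_subset_compl.2 (Set.Icc_subset_Icc (by linarith) hT)
  refine Tendsto.congr' h1 ?_
  rw [← integral_zero ℝ ℂ (μ := volume.restrict (Set.Icc (-T₀) T₀)ᶜ)]
  refine tendsto_integral_filter_of_dominated_convergence (fun τ => ‖f τ‖) ?_ ?_ hf.norm ?_
  · exact Eventually.of_forall fun T =>
      hf.aestronglyMeasurable.indicator measurableSet_Icc.compl
  · exact Eventually.of_forall fun T => ae_of_all _ fun τ => norm_indicator_le_norm_self _ _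
  · refine ae_of_all _ fun τ => tendsto_const_nhds.congr' ?_
    filter_upwards [eventually_ge_atTop |τ|] with T hT
    rw [Set.indicator_of_notMem]
    exact fun h => h (abs_le.1 hT)

theorem tendsto_integral_awayFrom_of_hasContourDiff {n : ℕ} (hn : 1 ≤ n) {x : ℂ} (hx : x ≠ 0)
    {T : ℝ} {D : ℂ} (hD : HasContourDiff (singularSet x) T (kernel n x) D)
    (hT : IntegrableOn (integrand n x) (Set.Icc (-T) T)ᶜ) :
    Tendsto (fun ε : ℝ => ∫ τ in awayFrom (singularSet x) ε, integrand n x τ) (𝓝[>] 0)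
      (𝓝 (Complex.exp (-n) / Complex.I *
        (D + ∫ y in (-angle T)..(angle T), kernel n x (vseg T y) * Complex.I) +
        ∫ τ in (Set.Icc (-T) T)ᶜ, integrand n x τ)) := by
  have hS := finite_singularSet hx
  have h1 := (Filter.Tendsto.const_mul (Complex.exp (-n) / Complex.I) hD).add
    (tendsto_setIntegral_awayFrom hS hT)
  refine h1.congr' ?_
  filter_upwards [self_mem_nhdsWithin] with ε hε
  rw [← integral_inter_add_sdiff (measurableSet_Icc (a := -T) (b := T))
    (integrableOn_integrand_awayFrom hn hx hε), Set.sdiff_eq, ← integral_const_mul]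
  congr 2
  ext τ
  rw [integrand_eq hx]

/-- With `Re w ≤ -1` and `n ≥ 1` one has `|e^{nw}| ≤ e^{Re w}` and `|w|^n ≥ 1`; the segment has
bounded length, so its integral decays. -/
theorem norm_kernel_vseg_le {n : ℕ} (hn : 1 ≤ n) {x : ℂ} (hx : x ≠ 0) {T y : ℝ}
    (hT : (curve T).re ≤ -1) (h : 1 / 2 ≤ ‖Complex.exp (vseg T y / x) - 1‖) :
    ‖kernel n x (vseg T y)‖ ≤ 2 / ‖x‖ * Real.exp (curve T).re := by
  have hx' := norm_pos_iff.2 hx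
  have hn' : (1 : ℝ) ≤ n := by exact_mod_cast hn
  have h1 : 1 ≤ ‖vseg T y‖ := by
    refine le_trans ?_ (Complex.abs_re_le_norm _)
    rw [vseg_re]
    linarith [neg_le_abs (curve T).re]
  have h2 : ‖Complex.exp (n * vseg T y)‖ ≤ Real.exp (curve T).re := by
    rw [Complex.norm_exp, Real.exp_le_exp, ← Complex.ofReal_natCast, Complex.re_ofReal_mul, vseg_re]
    nlinarith
  rw [kernel, norm_div, norm_mul, norm_mul, norm_pow]
  calc _ ≤ Real.exp (curve T).re / (1 * (‖x‖ * (1 / 2))) := by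
        have := one_le_pow₀ (n := n) h1
        gcongr
    _ = _ := by field_simp

/-- Passage to the limit in the residue theorem. -/
theorem hasPVIntegral_of_tendsto {n : ℕ} (hn : 1 ≤ n) {x : ℂ} (hx : x ≠ 0) {T : ℕ → ℝ}
    (hT : Tendsto T atTop atTop)
    (hV : ∀ᶠ N in atTop, ∀ y, |y| ≤ Real.pi → 1 / 2 ≤ ‖Complex.exp (vseg (T N) y / x) - 1‖)
    {A : ℕ → ℂ} {A' : ℂ} (hA : Tendsto A atTop (𝓝 A'))
    (hsum : ∀ᶠ N in atTop, ∀ᶠ M : ℕ in atTop,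
      (∑ k ∈ Finset.Icc 1 M, Complex.exp (n * pole x k) / pole x k ^ n *
        if (curve (T N)).re < (pole x k).re then (weight (pole x k) : ℂ) else 0) +
      (∑ k ∈ Finset.Icc 1 M, Complex.exp (n * pole x (-k)) / pole x (-k) ^ n *
        if (curve (T N)).re < (pole x (-k)).re then (weight (pole x (-k)) : ℂ) else 0) = A N) :
    HasPVIntegral (integrand n x) (singularSet x) (Complex.exp (-n) / Complex.I *
      (2 * Real.pi * Complex.I * (bernoulliCoeff (n * x) n / x ^ n + A'))) := by
  refine ⟨fun ε hε => integrableOn_integrand_awayFrom hn hx hε, ?_⟩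
  obtain ⟨T₀, hT₀, -⟩ := integrableOn_integrand_tail hn hx
  set L : ℕ → ℂ := fun N => Complex.exp (-n) / Complex.I *
    (2 * Real.pi * Complex.I * (bernoulliCoeff (n * x) n / x ^ n + A N) +
      ∫ y in (-angle (T N))..(angle (T N)), kernel n x (vseg (T N) y) * Complex.I) +
    ∫ τ in (Set.Icc (-(T N)) (T N))ᶜ, integrand n x τ with hL
  have hre : ∀ᶠ N in atTop, (curve (T N)).re ≤ -1 := (tendsto_curve_re.comp hT).eventually_le_atBot _
  have hVI : Tendsto (fun N => ∫ y in (-angle (T N))..(angle (T N)),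
      kernel n x (vseg (T N) y) * Complex.I) atTop (𝓝 0) := by
    have h1 : Tendsto (fun N => 2 / ‖x‖ * Real.exp (curve (T N)).re * (2 * Real.pi)) atTop (𝓝 0) := by
      have := ((Real.tendsto_exp_atBot.comp (tendsto_curve_re.comp hT)).const_mul
        (2 / ‖x‖)).mul_const (2 * Real.pi)
      simpa using this
    refine squeeze_zero_norm' ?_ h1
    filter_upwards [hre, hV, hT.eventually_ge_atTop 0] with N h1 h2 h3
    have h4 := angle_nonneg h3
    have h5 := angle_lt_pi (T N)
    refine (intervalIntegral.norm_integral_le_of_norm_le_const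
      (C := 2 / ‖x‖ * Real.exp (curve (T N)).re) fun y hy => ?_).trans ?_
    · rw [Set.uIoc_of_le (by linarith)] at hy
      rw [norm_mul, Complex.norm_I, mul_one]
      exact norm_kernel_vseg_le hn hx h1
        (h2 y (abs_le.2 ⟨by linarith [hy.1], by linarith [hy.2]⟩))
    · gcongr
      rw [abs_of_nonneg (by linarith)]
      linarith
  have hlim : Tendsto L atTop (𝓝 (Complex.exp (-n) / Complex.I *
      (2 * Real.pi * Complex.I * (bernoulliCoeff (n * x) n / x ^ n + A')))) := by
    have := ((((hA.const_add (bernoulliCoeff (n * x) n / x ^ n)).const_mul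
      (2 * Real.pi * Complex.I)).add hVI).const_mul
      (Complex.exp (-n) / Complex.I)).add ((tendsto_tail hT₀).comp hT)
    rw [add_zero, add_zero] at this
    exact this
  have hpv : ∀ᶠ N in atTop, Tendsto (fun ε : ℝ => ∫ τ in awayFrom (singularSet x) ε,
      integrand n x τ) (𝓝[>] 0) (𝓝 (L N)) := by
    filter_upwards [hre, hV, hT.eventually_ge_atTop 0, hT.eventually_ge_atTop T₀, hsum]
      with N h1 h2 h3 h4 h5
    have h6 := angle_nonneg h3
    have h7 := angle_lt_pi (T N)
    obtain ⟨ρ, hρ⟩ := hasContourDiff_kernel n hx h3 (by linarith) fun y hy he => by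
      have := h2 y (abs_le.2 ⟨by linarith [hy.1], by linarith [hy.2]⟩)
      rw [he, sub_self, norm_zero] at this
      norm_num at this
    -- Since `|pole x k| = 2π|x||k|`, this `M` makes `|k| ≤ M` cover all poles in the disc of radius
    -- `ρ`.
    obtain ⟨M, hM5, hM⟩ := (h5.and (eventually_ge_atTop ⌈ρ / (2 * Real.pi * ‖x‖)⌉₊)).exists
    set K₁ : Finset ℤ := (Finset.Icc 1 M).image fun k : ℕ => (k : ℤ) with hK₁
    set K₂ : Finset ℤ := (Finset.Icc 1 M).image fun k : ℕ => -(k : ℤ) with hK₂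
    have hdisj : Disjoint K₁ K₂ := by
      rw [Finset.disjoint_left]
      intro k hk₁ hk₂
      simp only [hK₁, hK₂, Finset.mem_image, Finset.mem_Icc] at hk₁ hk₂
      omega
    have h8 := hρ (K₁ ∪ K₂) (by
      simp only [hK₁, hK₂, Finset.mem_union, Finset.mem_image, Finset.mem_Icc]
      omega) (fun k hk0 hk => by
      have hxp : 0 < 2 * Real.pi * ‖x‖ := by have := norm_pos_iff.2 hx; positivity
      rw [norm_pole] at hk
      have h9 : |(k : ℝ)| < ρ / (2 * Real.pi * ‖x‖) := by rw [lt_div_iff₀ hxp]; linarith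
      have h10 : |(k : ℝ)| < M := (h9.trans_le (Nat.le_ceil _)).trans_le (by exact_mod_cast hM)
      have h11 : |k| < (M : ℤ) := by exact_mod_cast h10
      rw [abs_lt] at h11
      simp only [hK₁, hK₂, Finset.mem_union, Finset.mem_image, Finset.mem_Icc]
      rcases lt_or_gt_of_ne hk0 with h | h
      · right
        exact ⟨k.natAbs, by omega, by omega⟩
      · left
        exact ⟨k.natAbs, by omega, by omega⟩)
    rw [Finset.sum_union hdisj, hK₁, hK₂, Finset.sum_image (fun a _ b _ h => by simpa using h),
      Finset.sum_image (fun a _ b _ h => by simpa using h)] at h8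
    rw [hM5] at h8
    refine tendsto_integral_awayFrom_of_hasContourDiff hn hx h8 (hT₀.mono_set ?_)
    exact Set.compl_subset_compl.2 (Set.Icc_subset_Icc (by linarith) h4)
  -- For all large `N` the number `L N` is the same principal value, so this value equals the limit
  -- of `L`.
  obtain ⟨N₀, hN₀⟩ := hpv.exists
  have hconst : Tendsto L atTop (𝓝 (L N₀)) := by
    refine tendsto_const_nhds.congr' ?_
    filter_upwards [hpv] with N hN
    exact tendsto_nhds_unique hN₀ hN
  rw [tendsto_nhds_unique hlim hconst]
  exact hN₀

/-! ### Weights of poles as step functions of the argument -/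

theorem step_congr {a b : ℝ} (h₁ : 0 < a ↔ 0 < b) (h₂ : a = 0 ↔ b = 0) : step a = step b := by
  simp only [step, h₁, h₂]

theorem step_mul {c : ℝ} (hc : 0 < c) (a : ℝ) : step (c * a) = step a :=
  step_congr (mul_pos_iff_of_pos_left hc) (by simp [hc.ne'])

theorem weight_conj (a : ℂ) : weight ((starRingEnd ℂ) a) = weight a := by
  by_cases h : ∃ τ, angle τ = a.im
  · obtain ⟨τ, hτ⟩ := h
    rw [weight_eq hτ, weight_eq (τ := -τ) (by simp [angle_neg, hτ]), curve_re_neg]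
    simp
  · have h' : ¬ ∃ τ, angle τ = ((starRingEnd ℂ) a).im := by
      rintro ⟨τ, hτ⟩
      exact h ⟨-τ, by simp [angle_neg, hτ]⟩
    rw [weight, weight, dif_neg h, dif_neg h']

/-- At height `y = t Im z` the curve has abscissa `y cot y` and the point `tz` has abscissa `y cot
φ`, `φ = arg z`. Up to positive factors their difference is `sin (φ - y)`, which has the sign of `φ
- y` as both angles lie in `(0, π)`. -/
theorem weight_mul_of_im_pos {z : ℂ} (hz : 0 < z.im) {t : ℝ} (ht : 0 < t) :
    weight (t * z) = step (Complex.arg z / z.im - t) := by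
  have hφ0 : 0 < Complex.arg z :=
    lt_of_le_of_ne (Complex.arg_nonneg_iff.2 hz.le) fun h => by
      have := Complex.arg_eq_zero_iff.1 h.symm
      linarith [this.2]
  have hφπ : Complex.arg z < Real.pi := lt_of_le_of_ne (Complex.arg_le_pi z) fun h => by
    have := Complex.arg_eq_pi_iff.1 h
    linarith [this.2]
  have him : ((t : ℂ) * z).im = t * z.im := by simp
  have hre : ((t : ℂ) * z).re = t * z.re := by simp
  have hy : 0 < t * z.im := mul_pos ht hz
  have hscale : step (Complex.arg z / z.im - t) = step (Complex.arg z - t * z.im) := by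
    rw [← step_mul hz]
    congr 1
    field_simp
  rw [hscale]
  by_cases hyπ : t * z.im < Real.pi
  · obtain ⟨τ, -, hτ⟩ := exists_angle_eq_of_pos ⟨hy, hyπ⟩
    rw [weight_eq (hτ.trans him.symm), hre]
    have h1 := curve_re_mul_sin τ
    rw [hτ] at h1
    set φ := Complex.arg z
    set y := t * z.im with hy'
    have hs1 : 0 < Real.sin y := Real.sin_pos_of_pos_of_lt_pi hy hyπ
    have hs2 : 0 < Real.sin φ := Real.sin_pos_of_pos_of_lt_pi hφ0 hφπ
    have h2 : z.re * Real.sin φ = z.im * Real.cos φ := by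
      have hz0 : z ≠ 0 := fun h => by simp [h] at hz
      rw [Complex.sin_arg, Complex.cos_arg hz0]
      ring
    have h3 : (Real.sin y * Real.sin φ) * ((curve τ).re - t * z.re) = y * Real.sin (φ - y) := by
      rw [Real.sin_sub, hy']
      rw [hy'] at h1
      linear_combination Real.sin φ * h1 - t * Real.sin (t * z.im) * h2
    rw [← step_mul (mul_pos hs1 hs2), h3, step_mul hy]
    rcases lt_trichotomy φ y with h | h | h
    · rw [step_of_neg (sub_neg.2 h), step_of_neg]
      exact Real.sin_neg_of_neg_of_neg_pi_lt (by linarith) (by linarith)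
    · rw [h, sub_self, Real.sin_zero]
    · rw [step_of_pos (sub_pos.2 h), step_of_pos]
      exact Real.sin_pos_of_pos_of_lt_pi (by linarith) (by linarith)
  · rw [weight_eq_zero, step_of_neg (by linarith)]
    rw [him, abs_of_pos hy]
    exact not_lt.1 hyπ

/-- The lower half plane follows by reflection: the curve is symmetric, and `arg z` and `Im z` both
change sign. -/
theorem weight_mul {z : ℂ} (hz : z.im ≠ 0) {t : ℝ} (ht : 0 < t) :
    weight (t * z) = step (Complex.arg z / z.im - t) := by
  rcases lt_or_gt_of_ne hz with h | h
  · have h1 := weight_mul_of_im_pos (z := (starRingEnd ℂ) z) (by simpa using h) ht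
    have h2 : Complex.arg z ≠ Real.pi := fun h' => hz (Complex.arg_eq_pi_iff.1 h').2
    rw [Complex.arg_conj, if_neg h2, Complex.conj_im, neg_div_neg_eq] at h1
    rw [← h1, ← weight_conj]
    simp
  · exact weight_mul_of_im_pos h ht

theorem weight_ofReal (a : ℝ) : weight (a : ℂ) = step (1 - a) := by
  rw [weight_eq (τ := 0) (by simp [angle_zero]), curve_zero]
  simp

/-- Terms with `k > ⌊c⌋` have step value `0`; a term with `k = c`, of weight one half, is still
within the range of `cutoffSum`. -/
theorem sum_ite_eq_cutoffSum {c R : ℝ} {p : ℕ → ℝ} {r : ℕ → ℂ} {M : ℕ}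
    (hR : ∀ k ∈ Finset.Icc 1 ⌊c⌋₊, R < p k) (hM : ⌊c⌋₊ ≤ M) :
    (∑ k ∈ Finset.Icc 1 M, r k * if R < p k then (step (c - k) : ℂ) else 0) = cutoffSum c r := by
  rw [cutoffSum]
  symm
  calc _ = ∑ k ∈ Finset.Icc 1 ⌊c⌋₊, r k * if R < p k then (step (c - k) : ℂ) else 0 :=
        Finset.sum_congr rfl fun k hk => by rw [if_pos (hR k hk), mul_comm]
    _ = _ := by
      refine Finset.sum_subset (Finset.Icc_subset_Icc le_rfl hM) fun k hk hk' => ?_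
      have h1 : ⌊c⌋₊ < k := by
        simp only [Finset.mem_Icc] at hk hk'
        omega
      have h2 := Nat.lt_of_floor_lt h1
      rw [step_of_neg (by linarith)]
      simp

theorem mul_cutoffSum {c : ℝ} {a b : ℕ → ℂ} {u v : ℂ} (h : ∀ k, 1 ≤ k → u * a k = v * b k) :
    u * cutoffSum c a = v * cutoffSum c b := by
  rw [cutoffSum, cutoffSum, Finset.mul_sum, Finset.mul_sum]
  refine Finset.sum_congr rfl fun k hk => ?_
  linear_combination (step (c - k) : ℂ) * h k (Finset.mem_Icc.1 hk).1

/-! ### Solving for the Bernoulli polynomial and rewriting the residues -/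

/-- Solving the limit form of the residue theorem for the Bernoulli polynomial. -/
theorem beta_div_factorial_eq {n : ℕ} {x A₁ A₂ B₁ B₂ : ℂ} (hx : x ≠ 0) (h₁ : x ^ n * A₁ = B₁)
    (h₂ : x ^ n * A₂ = B₂) :
    beta n x / (n.factorial : ℂ) =
      ((Real.exp 1 : ℂ) * x) ^ n / (2 * (Real.pi : ℂ)) * (Complex.exp (-n) / Complex.I *
        (2 * Real.pi * Complex.I * (bernoulliCoeff (n * x) n / x ^ n + (A₁ + A₂)))) - B₁ - B₂ := by
  have h : ((Real.exp 1 : ℝ) : ℂ) ^ n * Complex.exp (-n) = 1 := by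
    rw [Complex.ofReal_exp, Complex.ofReal_one, ← Complex.exp_nat_mul, ← Complex.exp_add]
    simp
  have hπ : (Real.pi : ℂ) ≠ 0 := Complex.ofReal_ne_zero.2 Real.pi_ne_zero
  have hβ : beta n x / (n.factorial : ℂ) = bernoulliCoeff (n * x) n := rfl
  have h3 : ∀ b : ℂ, (Real.exp 1 : ℂ) ^ n * x ^ n / (2 * (Real.pi : ℂ)) *
      (Complex.exp (-n) / Complex.I * (2 * Real.pi * Complex.I * b)) =
      ((Real.exp 1 : ℂ) ^ n * Complex.exp (-n)) * (x ^ n * b) := fun b => by field_simp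
  rw [hβ, mul_pow, h3, h, ← h₁, ← h₂]
  field_simp
  ring

theorem pow_mul_residue_pos {n : ℕ} {x : ℂ} (hx : x ≠ 0) (k : ℕ) :
    x ^ n * (Complex.exp (n * pole x k) / pole x k ^ n) =
      1 / (2 * (Real.pi : ℂ)) ^ n *
        (Complex.exp (2 * k * Real.pi * Complex.I * n * x) / (Complex.I * k) ^ n) := by
  have h1 : (n : ℂ) * pole x k = 2 * k * Real.pi * Complex.I * n * x := by
    rw [pole]; push_cast; ring
  have h2 : pole x k ^ n = x ^ n * ((2 * Real.pi) ^ n * (Complex.I * k) ^ n) := by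
    rw [pole, ← mul_pow, ← mul_pow]; push_cast; ring
  have hxn := pow_ne_zero n hx
  rw [h1, h2, mul_div_assoc', mul_div_mul_left _ _ hxn, div_mul_div_comm, one_mul]

theorem pow_mul_residue_neg {n : ℕ} {x : ℂ} (hx : x ≠ 0) (k : ℕ) :
    x ^ n * (Complex.exp (n * pole x (-k)) / pole x (-k) ^ n) =
      1 / (2 * (Real.pi : ℂ)) ^ n *
        (Complex.exp (-(2 * k * Real.pi * Complex.I * n * x)) / (-Complex.I * k) ^ n) := by
  have h1 : (n : ℂ) * pole x (-k) = -(2 * k * Real.pi * Complex.I * n * x) := by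
    rw [pole]; push_cast; ring
  have h2 : pole x (-k) ^ n = x ^ n * ((2 * Real.pi) ^ n * (-Complex.I * k) ^ n) := by
    rw [pole, ← mul_pow, ← mul_pow]; push_cast; ring
  have hxn := pow_ne_zero n hx
  rw [h1, h2, mul_div_assoc', mul_div_mul_left _ _ hxn, div_mul_div_comm, one_mul]

theorem step_two_pi_mul (a b : ℝ) (k : ℕ) :
    step (a / b - 2 * Real.pi * k) = step (a / (2 * Real.pi * b) - k) := by
  rw [← step_mul (c := 2 * Real.pi) (by positivity) (a / (2 * Real.pi * b) - k)]
  congr 1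
  rw [mul_sub, mul_comm (2 * Real.pi) b, ← div_div, mul_div_cancel₀ _ (by positivity)]

/-! ### The case `Re x ≠ 0` -/

/-- The poles lie on the two rays through `ix` and `-ix`, off the real axis. Finitely many have
nonzero weight, and all of these are eventually to the right of the segment, so the sum of residues
is eventually constant. -/
theorem hasPVIntegral_of_re_ne_zero {n : ℕ} (hn : 1 ≤ n) {x : ℂ} (hre : x.re ≠ 0) :
    HasPVIntegral (integrand n x) (singularSet x) (Complex.exp (-n) / Complex.I *
      (2 * Real.pi * Complex.I * (bernoulliCoeff (n * x) n / x ^ n +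
        (cutoffSum (Complex.arg (Complex.I * x) / (2 * Real.pi * (Complex.I * x).im))
          (fun k => Complex.exp (n * pole x k) / pole x k ^ n) +
        cutoffSum (Complex.arg (-Complex.I * x) / (2 * Real.pi * (-Complex.I * x).im))
          (fun k => Complex.exp (n * pole x (-k)) / pole x (-k) ^ n))))) := by
  have hx : x ≠ 0 := fun h => hre (by simp [h])
  set c₁ := Complex.arg (Complex.I * x) / (2 * Real.pi * (Complex.I * x).im)
  set c₂ := Complex.arg (-Complex.I * x) / (2 * Real.pi * (-Complex.I * x).im)
  have hT : Tendsto (fun N : ℕ => (N : ℝ)) atTop atTop := tendsto_natCast_atTop_atTop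
  have hcur := tendsto_curve_re.comp hT
  refine hasPVIntegral_of_tendsto hn hx (T := fun N => N) hT ?_ tendsto_const_nhds ?_
  -- `|Re (w/x)| ≥ log 2` yields the required bound `1 - e^{-log 2} = 1/2`.
  · obtain ⟨R, hR⟩ := exists_forall_re_ge hre (Real.log 2)
    filter_upwards [hcur.eventually_le_atBot R] with N hN y hy
    refine le_trans ?_ (le_norm_exp_sub_one _)
    have h1 := hR (vseg N y) (by rw [vseg_re]; exact hN) (by rwa [vseg_im])
    have h2 := Real.exp_le_exp.2 (neg_le_neg h1)
    rw [Real.exp_neg (Real.log 2), Real.exp_log (by norm_num)] at h2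
    linarith
  · have hw₁ : ∀ k ∈ Finset.Icc 1 ⌊c₁⌋₊, ∀ᶠ N : ℕ in atTop,
        (curve N).re < (pole x (k : ℤ)).re := fun k _ => hcur.eventually_lt_atBot _
    have hw₂ : ∀ k ∈ Finset.Icc 1 ⌊c₂⌋₊, ∀ᶠ N : ℕ in atTop,
        (curve N).re < (pole x (-(k : ℤ))).re := fun k _ => hcur.eventually_lt_atBot _
    filter_upwards [(Filter.eventually_all_finset _).2 hw₁, (Filter.eventually_all_finset _).2 hw₂]
      with N h₁ h₂
    filter_upwards [eventually_ge_atTop ⌊c₁⌋₊, eventually_ge_atTop ⌊c₂⌋₊] with M hM₁ hM₂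
    rw [← sum_ite_eq_cutoffSum h₁ hM₁, ← sum_ite_eq_cutoffSum h₂ hM₂]
    congr 1
    · refine Finset.sum_congr rfl fun k hk => ?_
      have hk0 : 0 < (k : ℝ) := by exact_mod_cast (Finset.mem_Icc.1 hk).1
      have hp : pole x (k : ℤ) = ((2 * Real.pi * k : ℝ) : ℂ) * (Complex.I * x) := by
        rw [pole]; push_cast; ring
      rw [← step_two_pi_mul, ← weight_mul (by simpa using hre) (by positivity), ← hp]
    · refine Finset.sum_congr rfl fun k hk => ?_
      have hk0 : 0 < (k : ℝ) := by exact_mod_cast (Finset.mem_Icc.1 hk).1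
      have hp : pole x (-(k : ℤ)) = ((2 * Real.pi * k : ℝ) : ℂ) * (-Complex.I * x) := by
        rw [pole]; push_cast; ring
      rw [← step_two_pi_mul, ← weight_mul (by simpa using hre) (by positivity), ← hp]

/-! ### The case of purely imaginary `x` -/

theorem exists_curve_re_eq {R : ℝ} (hR : R ≤ 1) : ∃ T, 0 ≤ T ∧ (curve T).re = R := by
  have hc : Continuous fun t => (curve t).re := Complex.continuous_re.comp continuous_curve
  obtain ⟨b, hb, hb0⟩ := ((tendsto_curve_re.eventually_le_atBot R).and
    (eventually_ge_atTop 0)).exists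
  obtain ⟨T, hT, h⟩ := intermediate_value_Icc' hb0 hc.continuousOn
    (show R ∈ Set.Icc (curve b).re (curve 0).re from ⟨hb, by simpa [curve_zero] using hR⟩)
  exact ⟨T, hT.1, h⟩

/-- Heights at which the vertical segment passes between the poles, if these are real. -/
theorem exists_tendsto_heights {q : ℝ} (hq : 0 < q) :
    ∃ T : ℕ → ℝ, Tendsto T atTop atTop ∧
      ∀ N, (curve (T N)).re = -(q * (2 * Real.pi * N + Real.pi)) := by
  have h1 : ∀ N : ℕ, ∃ T, 0 ≤ T ∧ (curve T).re = -(q * (2 * Real.pi * N + Real.pi)) := fun N => by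
    have : 0 ≤ q * (2 * Real.pi * N + Real.pi) := by positivity
    exact exists_curve_re_eq (by linarith)
  choose T hT0 hT using h1
  refine ⟨T, tendsto_atTop.2 fun b => ?_, hT⟩
  have h2 : Tendsto (fun N : ℕ => q * (2 * Real.pi * (N : ℝ) + Real.pi)) atTop atTop :=
    ((tendsto_natCast_atTop_atTop.const_mul_atTop Real.two_pi_pos).atTop_add
      tendsto_const_nhds).const_mul_atTop hq
  filter_upwards [h2.eventually_gt_atTop (-(curve |b|).re)] with N hN
  by_contra! hc
  have := curve_re_le_of_abs_le (σ := T N) (T := |b|) (by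
    rw [abs_of_nonneg (hT0 N)]; exact hc.le.trans (le_abs_self b))
  rw [hT] at this
  linarith

theorem one_le_norm_exp_vseg_sub_one {q : ℝ} (hq : q ≠ 0) {T : ℝ} {N : ℕ}
    (hT : (curve T).re = -(|q| * (2 * Real.pi * N + Real.pi))) (y : ℝ) :
    1 ≤ ‖Complex.exp (vseg T y / (Complex.I * q)) - 1‖ := by
  have hq' : (q : ℂ) ≠ 0 := Complex.ofReal_ne_zero.2 hq
  -- The abscissa is midway between two poles, so `Im (w/x)` is an odd multiple of `π` and `e^{w/x}`
  -- is a negative real. For `q < 0` it is `-(2N + 1)π = π + 2π(-N - 1)`.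
  have key : Complex.exp (vseg T y / (Complex.I * q)) = -Complex.exp ((y / q : ℝ) : ℂ) := by
    rcases abs_choice q with h | h
    · have h1 : vseg T y / (Complex.I * q) = (y / q : ℝ) + (Real.pi * Complex.I
          + (N : ℤ) * (2 * Real.pi * Complex.I)) := by
        rw [vseg, hT, h]
        push_cast
        rw [div_eq_iff (by simp [hq'])]
        field_simp
        linear_combination (-(2 * (q : ℂ) * Real.pi * N) - q * Real.pi) * Complex.I_sq
      rw [h1, Complex.exp_add, Complex.exp_add, Complex.exp_int_mul_two_pi_mul_I, Complex.exp_pi_mul_I]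
      ring
    · have h1 : vseg T y / (Complex.I * q) = (y / q : ℝ) + (Real.pi * Complex.I
          + ((-N - 1 : ℤ) : ℂ) * (2 * Real.pi * Complex.I)) := by
        rw [vseg, hT, h]
        push_cast
        rw [div_eq_iff (by simp [hq'])]
        field_simp
        linear_combination ((2 * (q : ℂ) * Real.pi * N) + q * Real.pi) * Complex.I_sq
      rw [h1, Complex.exp_add, Complex.exp_add, Complex.exp_int_mul_two_pi_mul_I, Complex.exp_pi_mul_I]
      ring
  have h2 : -Complex.exp ((y / q : ℝ) : ℂ) - 1 = -((Real.exp (y / q) + 1 : ℝ) : ℂ) := by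
    push_cast; ring
  rw [key, h2, norm_neg, Complex.norm_real, Real.norm_eq_abs]
  have := Real.exp_pos (y / q)
  exact le_trans (by linarith) (le_abs_self _)

/-- Negative real poles all lie inside the curve, which crosses the real axis at `1`; exactly the
first `N` of them are to the right of the segment. The result is a partial sum of the polylogarithm
series. -/
theorem sum_left_poles {Q R : ℝ} (hQ : 0 < Q) {N M : ℕ} (hNM : N ≤ M)
    (hR : R = -(Q * (2 * Real.pi * N + Real.pi))) {p r : ℕ → ℂ}
    (hp : ∀ k, p k = ((-(2 * Real.pi * k * Q) : ℝ) : ℂ)) :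
    (∑ k ∈ Finset.Icc 1 M, r k * if R < (p k).re then (weight (p k) : ℂ) else 0) =
      ∑ k ∈ Finset.range N, r (k + 1) := by
  have hπ := Real.pi_pos
  have h1 : ∀ k : ℕ, R < (p k).re ↔ k ≤ N := fun k => by
    rw [hp, Complex.ofReal_re, hR, neg_lt_neg_iff]
    have h2 : 2 * Real.pi * k * Q < Q * (2 * Real.pi * N + Real.pi) ↔
        (2 * Real.pi) * k < (2 * Real.pi) * N + Real.pi := by
      rw [mul_comm _ Q, mul_lt_mul_iff_right₀ hQ]
    rw [h2]
    constructor
    · intro h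
      by_contra! hc
      have : (N : ℝ) + 1 ≤ k := by exact_mod_cast hc
      nlinarith
    · intro h
      have : (k : ℝ) ≤ N := by exact_mod_cast h
      nlinarith
  have h3 : ∀ k : ℕ, weight (p k) = 1 := fun k => by
    rw [hp, weight_ofReal, step_of_pos]
    have : 0 ≤ 2 * Real.pi * k * Q := by positivity
    linarith
  simp only [h1, h3, Complex.ofReal_one]
  have h4 : ∑ k ∈ Finset.range N, r (k + 1) = ∑ k ∈ Finset.Ico 1 (N + 1), r k := by
    rw [Finset.sum_Ico_eq_sum_range]
    simp [add_comm]
  rw [h4]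
  symm
  calc _ = ∑ k ∈ Finset.Icc 1 N, r k * if k ≤ N then 1 else 0 := by
        refine Finset.sum_congr (by ext; simp) fun k hk => ?_
        rw [if_pos (by simp at hk; omega), mul_one]
    _ = _ := Finset.sum_subset (Finset.Icc_subset_Icc le_rfl hNM) fun k hk hk' => by
        rw [if_neg (by simp at hk hk'; omega), mul_zero]

/-- A positive real pole `2πkQ` is inside exactly when it is less than `1`, which is the cutoff `1 /
(2πQ)`. -/
theorem sum_right_poles {Q R : ℝ} (hQ : 0 < Q) (hR : R < 0) {M : ℕ}
    (hM : ⌊1 / (2 * Real.pi * Q)⌋₊ ≤ M) {p r : ℕ → ℂ}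
    (hp : ∀ k, p k = ((2 * Real.pi * k * Q : ℝ) : ℂ)) :
    (∑ k ∈ Finset.Icc 1 M, r k * if R < (p k).re then (weight (p k) : ℂ) else 0) =
      cutoffSum (1 / (2 * Real.pi * Q)) r := by
  have hπ := Real.pi_pos
  rw [← sum_ite_eq_cutoffSum (R := R) (p := fun k => (p k).re) (fun k _ => ?_) hM]
  · refine Finset.sum_congr rfl fun k _ => ?_
    have h1 : weight (p k) = step (1 / (2 * Real.pi * Q) - k) := by
      rw [hp, weight_ofReal, ← step_mul (c := 2 * Real.pi * Q) (by positivity)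
        (1 / (2 * Real.pi * Q) - k)]
      congr 1
      field_simp
    rw [h1]
  · rw [hp, Complex.ofReal_re]
    have : 0 ≤ 2 * Real.pi * k * Q := by positivity
    linarith

theorem hasSum_polylog (n : ℕ) {z : ℂ} (hz : ‖z‖ < 1) :
    HasSum (fun k : ℕ => z ^ (k + 1) / ((k : ℂ) + 1) ^ n) (polylog n z) := by
  refine Summable.hasSum (Summable.of_norm_bounded (g := fun k : ℕ => ‖z‖ ^ k)
    (summable_geometric_of_lt_one (norm_nonneg _) hz) fun k => ?_)
  have h1 : (1 : ℝ) ≤ ‖((k : ℂ) + 1) ^ n‖ := by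
    rw [norm_pow]
    refine one_le_pow₀ ?_
    have : ((k : ℂ) + 1) = ((k + 1 : ℕ) : ℂ) := by push_cast; ring
    rw [this, Complex.norm_natCast]
    push_cast
    linarith [(Nat.cast_nonneg k : (0 : ℝ) ≤ k)]
  rw [norm_div, norm_pow]
  calc _ ≤ ‖z‖ ^ (k + 1) / 1 := by gcongr
    _ ≤ ‖z‖ ^ k := by
      rw [div_one]
      exact pow_le_pow_of_le_one (norm_nonneg _) hz.le (Nat.le_succ k)

theorem hasPVIntegral_of_pos {n : ℕ} (hn : 1 ≤ n) {q : ℝ} (hq : 0 < q) {x : ℂ}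
    (hxq : x = Complex.I * q) {Z : ℂ}
    (hZ : HasSum (fun k : ℕ => Complex.exp (n * pole x ((k + 1 : ℕ) : ℤ))
      / pole x ((k + 1 : ℕ) : ℤ) ^ n) Z) :
    HasPVIntegral (integrand n x) (singularSet x) (Complex.exp (-n) / Complex.I *
      (2 * Real.pi * Complex.I * (bernoulliCoeff (n * x) n / x ^ n +
        (Z + cutoffSum (1 / (2 * Real.pi * q))
          (fun k => Complex.exp (n * pole x (-k)) / pole x (-k) ^ n))))) := by
  have hx : x ≠ 0 := by rw [hxq]; simp [hq.ne']
  obtain ⟨T, hT, hTre⟩ := exists_tendsto_heights hq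
  refine hasPVIntegral_of_tendsto hn hx hT ?_ (hZ.tendsto_sum_nat.add_const _) ?_
  · refine Eventually.of_forall fun N y _ => ?_
    have := one_le_norm_exp_vseg_sub_one hq.ne' (T := T N) (N := N)
      (by rw [hTre, abs_of_pos hq]) y
    rw [hxq]; linarith
  · refine Eventually.of_forall fun N => ?_
    filter_upwards [eventually_ge_atTop N, eventually_ge_atTop ⌊1 / (2 * Real.pi * q)⌋₊]
      with M h1 h2
    have hneg : (curve (T N)).re < 0 := by
      rw [hTre]
      have : 0 < q * (2 * Real.pi * N + Real.pi) := by positivity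
      linarith
    congr 1
    · refine sum_left_poles hq h1 (hTre N) (p := fun k => pole x k)
        (r := fun k => Complex.exp (n * pole x k) / pole x k ^ n) fun k => ?_
      rw [pole, hxq]; push_cast
      linear_combination 2 * Real.pi * (k : ℂ) * q * Complex.I_sq
    · refine sum_right_poles hq hneg h2 (p := fun k => pole x (-k)) fun k => ?_
      rw [pole, hxq]; push_cast
      linear_combination -2 * Real.pi * (k : ℂ) * q * Complex.I_sq

theorem hasPVIntegral_of_neg {n : ℕ} (hn : 1 ≤ n) {q : ℝ} (hq : q < 0) {x : ℂ}
    (hxq : x = Complex.I * q) {Z : ℂ}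
    (hZ : HasSum (fun k : ℕ => Complex.exp (n * pole x (-((k + 1 : ℕ) : ℤ)))
      / pole x (-((k + 1 : ℕ) : ℤ)) ^ n) Z) :
    HasPVIntegral (integrand n x) (singularSet x) (Complex.exp (-n) / Complex.I *
      (2 * Real.pi * Complex.I * (bernoulliCoeff (n * x) n / x ^ n +
        (cutoffSum (1 / (2 * Real.pi * (-q)))
          (fun k => Complex.exp (n * pole x k) / pole x k ^ n) + Z)))) := by
  have hx : x ≠ 0 := by rw [hxq]; simp [hq.ne]
  have hq' : 0 < -q := by linarith
  obtain ⟨T, hT, hTre⟩ := exists_tendsto_heights hq'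
  refine hasPVIntegral_of_tendsto hn hx hT ?_ (hZ.tendsto_sum_nat.const_add _) ?_
  · refine Eventually.of_forall fun N y _ => ?_
    have := one_le_norm_exp_vseg_sub_one hq.ne (T := T N) (N := N)
      (by rw [hTre, abs_of_neg hq]) y
    rw [hxq]; linarith
  · refine Eventually.of_forall fun N => ?_
    filter_upwards [eventually_ge_atTop N, eventually_ge_atTop ⌊1 / (2 * Real.pi * (-q))⌋₊]
      with M h1 h2
    have hneg : (curve (T N)).re < 0 := by
      rw [hTre]
      have : 0 < -q * (2 * Real.pi * N + Real.pi) := by positivity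
      linarith
    congr 1
    · refine sum_right_poles hq' hneg h2 (p := fun k => pole x k) fun k => ?_
      rw [pole, hxq]; push_cast
      linear_combination 2 * Real.pi * (k : ℂ) * q * Complex.I_sq
    · refine sum_left_poles hq' h1 (hTre N) (p := fun k => pole x (-k))
        (r := fun k => Complex.exp (n * pole x (-k)) / pole x (-k) ^ n) fun k => ?_
      rw [pole, hxq]; push_cast
      linear_combination -2 * Real.pi * (k : ℂ) * q * Complex.I_sq

/-- The residues at the poles of one sign sum up to a polylogarithm. -/
theorem hasSum_residues {n : ℕ} {x s : ℂ} {p : ℕ → ℂ}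
    (hp : ∀ k : ℕ, p k = s * (k + 1) * x)
    (hz : ‖Complex.exp (s * n * x)‖ < 1) :
    HasSum (fun k : ℕ => Complex.exp (n * p k) / p k ^ n)
      (1 / x ^ n * (1 / s ^ n * polylog n (Complex.exp (s * n * x)))) := by
  refine (((hasSum_polylog n hz).mul_left (1 / s ^ n)).mul_left (1 / x ^ n)).congr_fun ?_
  intro k
  rw [← Complex.exp_nat_mul, hp, mul_pow, mul_pow,
    show (n : ℂ) * (s * (k + 1) * x) = ((k + 1 : ℕ) : ℂ) * (s * n * x) by push_cast; ring]
  rw [div_mul_div_comm, div_mul_div_comm, one_mul, one_mul]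
  congr 1
  ring

theorem norm_exp_lt_one_of_re_neg {u : ℂ} (h : u.re < 0) : ‖Complex.exp u‖ < 1 := by
  rw [Complex.norm_exp, Real.exp_lt_one_iff]; exact h

end RescaledBernoulli

/-! ### Assembly of the three cases -/

open RescaledBernoulli in
theorem mainTheorem4 (n : ℕ) (hn : 1 ≤ n) (x : ℂ) (hx : x ≠ 0) :
    ∃ J : ℂ,
      RescaledBernoulli.HasPVIntegral (RescaledBernoulli.integrand n x)
        (RescaledBernoulli.singularSet x) J ∧
      (x.re ≠ 0 →
        RescaledBernoulli.beta n x / (n.factorial : ℂ) =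
          ((Real.exp 1 : ℂ) * x) ^ n / (2 * (Real.pi : ℂ)) * J
          - 1 / (2 * (Real.pi : ℂ)) ^ n *
            RescaledBernoulli.cutoffSum
              (Complex.arg (Complex.I * x) / (2 * Real.pi * (Complex.I * x).im))
              (fun k => Complex.exp (2 * k * Real.pi * Complex.I * n * x)
                / (Complex.I * k) ^ n)
          - 1 / (2 * (Real.pi : ℂ)) ^ n *
            RescaledBernoulli.cutoffSum
              (Complex.arg (-Complex.I * x) / (2 * Real.pi * (-Complex.I * x).im))
              (fun k => Complex.exp (-(2 * k * Real.pi * Complex.I * n * x))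
                / (-Complex.I * k) ^ n)) ∧
      (∀ q : ℝ, 0 < q → x = Complex.I * q →
        RescaledBernoulli.beta n x / (n.factorial : ℂ) =
          ((Real.exp 1 : ℂ) * x) ^ n / (2 * (Real.pi : ℂ)) * J
          - 1 / (2 * (Real.pi : ℂ) * Complex.I) ^ n *
            RescaledBernoulli.polylog n (Complex.exp (2 * Real.pi * Complex.I * n * x))
          - 1 / (2 * (Real.pi : ℂ)) ^ n *
            RescaledBernoulli.cutoffSum (1 / (2 * Real.pi * x.im))
              (fun k => Complex.exp (-(2 * Real.pi * Complex.I * k * n * x))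
                / (-Complex.I * k) ^ n)) ∧
      (∀ q : ℝ, q < 0 → x = Complex.I * q →
        RescaledBernoulli.beta n x / (n.factorial : ℂ) =
          ((Real.exp 1 : ℂ) * x) ^ n / (2 * (Real.pi : ℂ)) * J
          - 1 / (-(2 * (Real.pi : ℂ) * Complex.I)) ^ n *
            RescaledBernoulli.polylog n (Complex.exp (-(2 * Real.pi * Complex.I * n * x)))
          - 1 / (2 * (Real.pi : ℂ)) ^ n *
            RescaledBernoulli.cutoffSum (1 / (2 * Real.pi * (-x.im)))
              (fun k => Complex.exp (2 * Real.pi * Complex.I * k * n * x)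
                / (Complex.I * k) ^ n)) := by
  have hxn := pow_ne_zero n hx
  have hn' : (0 : ℝ) < n := by exact_mod_cast hn
  have hπ := Real.pi_pos
  by_cases hre : x.re ≠ 0
  · refine ⟨_, hasPVIntegral_of_re_ne_zero hn hre, fun _ => ?_, fun q _ h => ?_, fun q _ h => ?_⟩
    · exact beta_div_factorial_eq hx (mul_cutoffSum fun k _ => pow_mul_residue_pos hx k)
        (mul_cutoffSum fun k _ => pow_mul_residue_neg hx k)
    · exact absurd (by simp [h]) hre
    · exact absurd (by simp [h]) hre
  · rw [not_not] at hre
    have hxq : x = Complex.I * (x.im : ℂ) := by apply Complex.ext <;> simp [hre]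
    rcases lt_trichotomy x.im 0 with h | h | h
    · have hZ := hasSum_residues (n := n) (x := x) (s := -(2 * Real.pi * Complex.I))
        (p := fun k => pole x (-((k + 1 : ℕ) : ℤ))) (fun k => by rw [pole]; push_cast; ring)
        (norm_exp_lt_one_of_re_neg (by
          rw [show -(2 * Real.pi * Complex.I) * n * x = ((2 * Real.pi * n * x.im : ℝ) : ℂ) by
            nth_rewrite 1 [hxq]; push_cast
            linear_combination (-2 * Real.pi * (n : ℂ) * x.im) * Complex.I_sq, Complex.ofReal_re]
          exact mul_neg_of_pos_of_neg (by positivity) h))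
      refine ⟨_, hasPVIntegral_of_neg hn h hxq hZ, fun h' => absurd hre h', fun q hq hq' => ?_,
        fun q _ _ => ?_⟩
      · rw [hq'] at h; simp at h; linarith
      · have hW : ∀ k : ℕ, x ^ n * (Complex.exp (n * pole x k) / pole x k ^ n) =
            1 / (2 * (Real.pi : ℂ)) ^ n *
              (Complex.exp (2 * Real.pi * Complex.I * k * n * x) / (Complex.I * k) ^ n) :=
          fun k => by rw [pow_mul_residue_pos hx, mul_right_comm 2 (k : ℂ), mul_right_comm _ (k : ℂ)]
        -- For `q < 0` the infinite family of poles is the one with negative index, so the finite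
        -- sum comes first in the residue formula.
        rw [sub_right_comm]
        refine beta_div_factorial_eq hx (mul_cutoffSum fun k _ => hW k) ?_
        rw [← mul_assoc (x ^ n), mul_one_div_cancel hxn, one_mul]
        simp only [neg_mul]
    · exact absurd (Complex.ext hre h) hx
    · have hZ := hasSum_residues (n := n) (x := x) (s := 2 * Real.pi * Complex.I)
        (p := fun k => pole x ((k + 1 : ℕ) : ℤ)) (fun k => by rw [pole]; push_cast; ring)
        (norm_exp_lt_one_of_re_neg (by
          rw [show 2 * Real.pi * Complex.I * n * x = ((-(2 * Real.pi * n * x.im) : ℝ) : ℂ) by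
            nth_rewrite 1 [hxq]; push_cast
            linear_combination (2 * Real.pi * (n : ℂ) * x.im) * Complex.I_sq, Complex.ofReal_re]
          have : 0 < 2 * Real.pi * n * x.im := by positivity
          linarith))
      refine ⟨_, hasPVIntegral_of_pos hn h hxq hZ, fun h' => absurd hre h', fun q _ _ => ?_,
        fun q hq hq' => ?_⟩
      · have hW : ∀ k : ℕ, x ^ n * (Complex.exp (n * pole x (-k)) / pole x (-k) ^ n) =
            1 / (2 * (Real.pi : ℂ)) ^ n *
              (Complex.exp (-(2 * Real.pi * Complex.I * k * n * x)) / (-Complex.I * k) ^ n) :=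
          fun k => by rw [pow_mul_residue_neg hx, mul_right_comm 2 (k : ℂ), mul_right_comm _ (k : ℂ)]
        refine beta_div_factorial_eq hx ?_ (mul_cutoffSum fun k _ => hW k)
        rw [← mul_assoc (x ^ n), mul_one_div_cancel hxn, one_mul]
      · rw [hq'] at h; simp at h; linarith
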